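/- Let $X$ be a real or complex Banach space. $X$ has the complete continuity property (CCP) if every bounded linear operator $T\colon L_1[0,1]\to X$ is completely continuous, i.e. maps weakly convergent sequences to norm convergent sequences (here $L_1[0,1]$ is taken with respect to Lebesgue measure and has the same scalar field as $X$). A sequence $(V_n)_{n\ge 0}$ of finite dimensional subspaces of a Banach space $Y$ is a finite dimensional decomposition of $Y$ with constant at most $C$ if every $y\in Y$ has a unique expansion $y=\sum_{n=0}^\infty v_n$ (norm convergence) with $v_n\in V_n$ for all $n$, and $\bigl\|\sum_{n<N}v_n\bigr\|\le C\,\|y\|$ for every such $y$ and every $N\ge 0$. If $X$ fails the CCP, then for every $\varepsilon>0$ there is a closed subspace $Y$ of $X$ such that $Y$ has a finite dimensional decomposition with constant at most $1+\varepsilon$, and $Y$ itself fails the CCP. -/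

import Mathlib

open MeasureTheory Filter Topology

/-- `L¹[0,1]` with scalars in `𝕜`, for Lebesgue measure on the unit interval. -/
abbrev LOne (𝕜 : Type*) [RCLike 𝕜] : Type _ :=
  Lp 𝕜 1 (volume : Measure unitInterval)

/-- A bounded linear operator is completely continuous if it maps weakly convergent sequences to
norm convergent sequences. (The norm limit is then necessarily the image of the weak limit.) -/
def IsCompletelyContinuous {𝕜 E F : Type*} [RCLike 𝕜]
    [NormedAddCommGroup E] [NormedSpace 𝕜 E] [NormedAddCommGroup F] [NormedSpace 𝕜 F]
    (T : E →L[𝕜] F) : Prop :=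
  ∀ (u : ℕ → E) (f : E),
    Tendsto (fun n => toWeakSpace 𝕜 E (u n)) atTop (𝓝 (toWeakSpace 𝕜 E f)) →
    Tendsto (fun n => T (u n)) atTop (𝓝 (T f))

/-- The complete continuity property (CCP): every bounded linear operator from `L¹[0,1]` into the
space is completely continuous. -/
def CompleteContinuityProperty (𝕜 E : Type*) [RCLike 𝕜]
    [NormedAddCommGroup E] [NormedSpace 𝕜 E] : Prop :=
  ∀ T : LOne 𝕜 →L[𝕜] E, IsCompletelyContinuous T

/-- `∑ n, v n = x`, with convergence in norm of the partial sums taken in order, where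
`v n ∈ V n` for every `n`. -/
def IsExpansion {𝕜 E : Type*} [RCLike 𝕜] [NormedAddCommGroup E] [NormedSpace 𝕜 E]
    (V : ℕ → Submodule 𝕜 E) (v : (n : ℕ) → V n) (x : E) : Prop :=
  Tendsto (fun N : ℕ => ∑ n ∈ Finset.range N, (v n : E)) atTop (𝓝 x)

/-- `V 0, V 1, …` is a finite dimensional decomposition of the space `E`: each `V n` is a finite
dimensional subspace and every `x` in `E` has a unique expansion `x = ∑ n, v n`, `v n ∈ V n`. -/
structure IsFDD {𝕜 E : Type*} [RCLike 𝕜] [NormedAddCommGroup E] [NormedSpace 𝕜 E]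
    (V : ℕ → Submodule 𝕜 E) : Prop where
  finiteDimensional : ∀ n, FiniteDimensional 𝕜 (V n)
  existsUnique_expansion : ∀ x : E, ∃! v : (n : ℕ) → V n, IsExpansion V v x

/-- `V 0, V 1, …` is a finite dimensional decomposition of `E` with constant at most `C`: all the
partial sum projections `∑ n, v n ↦ ∑ n < N, v n` have norm at most `C`. -/
structure IsFDDWithConstantLE {𝕜 E : Type*} [RCLike 𝕜] [NormedAddCommGroup E] [NormedSpace 𝕜 E]
    (V : ℕ → Submodule 𝕜 E) (C : ℝ) : Prop extends IsFDD V where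
  norm_partialSum_le : ∀ (v : (n : ℕ) → V n) (x : E), IsExpansion V v x →
    ∀ N : ℕ, ‖∑ n ∈ Finset.range N, (v n : E)‖ ≤ C * ‖x‖

/-!
Let `T : L¹[0,1] → X` fail to be completely continuous. The theorem is proved by replacing `T` with
an operator `R : L¹[0,1] → X` which is still bounded away from zero on the (weakly null) Rademacher
functions `rₙ`, and whose range is spanned by the differences of an `X`-valued dyadic martingale
that are so spread out that they form a finite dimensional decomposition.

*Room for choice.* Weakly null sequences in `L¹` are uniformly integrable
(`exists_norm_indicatorLOne_le`), hence close in norm to bounded sequences; so `T` is not compact on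
`C[0,1]` with the supremum norm (`isCompletelyContinuous_of_totallyBounded`). An operator which is
small on the unit ball of some common kernel of finitely many functionals, for every degree of
smallness, is compact (`totallyBounded_image_closedBall`). So there is `δ > 0` such that any finite
number of linear conditions on `C[0,1]` is satisfied by some `g` with `‖g‖ ≤ 1` and `‖T g‖ ≥ δ`.

*The martingale.* Functions `g₀, g₁, …` are chosen one after the other in this way. The conditions
`∫ gₙ ∏_{i ∈ A} gᵢ = 0` for `A ⊆ {0, …, n - 1}` make each Riesz product `∏_{i < n} (1 + rᵢ(t) gᵢ)` a
nonnegative function of integral one, so the martingale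
`t ↦ T (∏_{i < n} (1 + rᵢ(t) gᵢ)) = ∑_A r_A(t) T(g_A)`, with `r_A = ∏_{i ∈ A} rᵢ` and
`g_A = ∏_{i ∈ A} gᵢ`, is bounded by `‖T‖` (`norm_continuousToLOne_rieszProduct`). A bounded dyadic
martingale is the same thing as an operator `R` on `L¹[0,1]` (`exists_operator_of_walsh`), and here
`R rₙ = T gₙ`. No sign-valued functions, and no Lyapunov type theorem, are needed.

*The decomposition.* The `n`-th difference of the martingale has its values in the span `Vₙ₊₁` of
the finitely many vectors `T (gₙ g_A)`, `A ⊆ {0, …, n - 1}`. By Mazur's method, `gₙ` is also chosen so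
that `Vₙ₊₁` is annihilated by finite sets of functionals which `(1 + ε)`-norm `V₀ + ⋯ + Vⱼ`, for
`j ≤ n` (`exists_finset_norming`). Then the partial sum projections have norm at most `1 + ε`, and
`(Vₙ)` is a decomposition of its closed span `Y` (`isFDDWithConstantLE_of_norm_sum_le`). The range
of `R` lies in `Y`, and `‖R rₙ‖ ≥ δ`, so `Y` fails the complete continuity property.
-/

/-! ### Weak convergence, compactness and norming functionals -/

theorem tendsto_toWeakSpace_iff {𝕜 E : Type*} [RCLike 𝕜] [NormedAddCommGroup E] [NormedSpace 𝕜 E]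
    {u : ℕ → E} {f : E} :
    Tendsto (fun n => toWeakSpace 𝕜 E (u n)) atTop (𝓝 (toWeakSpace 𝕜 E f)) ↔
      ∀ φ : StrongDual 𝕜 E, Tendsto (fun n => φ (u n)) atTop (𝓝 (φ f)) := by
  refine WeakBilin.tendsto_iff_forall_eval_tendsto (B := (topDualPairing 𝕜 E).flip) ?_
  intro x y hxy
  by_contra hne
  obtain ⟨φ, hφ⟩ := SeparatingDual.exists_separating_of_ne (R := 𝕜) hne
  exact hφ (congrArg (fun l => l φ) hxy)

/-- On totally bounded sequences, weak convergence to zero implies norm convergence. -/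
theorem tendsto_zero_of_totallyBounded_of_weak {𝕜 X : Type*} [RCLike 𝕜] [NormedAddCommGroup X]
    [NormedSpace 𝕜 X] [CompleteSpace X] {x : ℕ → X} (hx : TotallyBounded (Set.range x))
    (hw : ∀ φ : StrongDual 𝕜 X, Tendsto (fun n => φ (x n)) atTop (𝓝 0)) :
    Tendsto x atTop (𝓝 0) := by
  have hc : IsCompact (closure (Set.range x)) :=
    isCompact_iff_totallyBounded_isComplete.2 ⟨hx.closure, isClosed_closure.isComplete⟩
  refine tendsto_of_subseq_tendsto fun ns hns => ?_
  obtain ⟨z, -, ms, hms, hz⟩ :=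
    hc.tendsto_subseq (x := fun n => x (ns n)) fun n => subset_closure ⟨_, rfl⟩
  refine ⟨ms, ?_⟩
  have hz0 : z = 0 := by
    refine (SeparatingDual.eq_zero_iff_forall_dual_eq_zero (R := 𝕜) z).2 fun φ => ?_
    exact tendsto_nhds_unique ((φ.continuous.tendsto z).comp hz)
      ((hw φ).comp (hns.comp hms.tendsto_atTop))
  simpa [hz0] using! hz

/-- An operator that is as small as desired on the unit ball of a suitable common kernel of
finitely many functionals is compact. The functionals map the ball onto a totally bounded set, and
a vector on which they are small is close to their common kernel. -/
theorem totallyBounded_image_closedBall {𝕜 E X : Type*} [RCLike 𝕜]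
    [NormedAddCommGroup E] [NormedSpace ℝ E] [NormedAddCommGroup X] [NormedSpace ℝ X]
    (K : E →L[ℝ] X)
    (hK : ∀ δ > 0, ∃ s : Finset (E →L[ℝ] 𝕜), ∀ y : E, ‖y‖ ≤ 1 → (∀ φ ∈ s, φ y = 0) → ‖K y‖ < δ)
    (M : ℝ) : TotallyBounded (K '' Metric.closedBall 0 M) := by
  classical
  rw [Metric.totallyBounded_iff]
  intro ε hε
  set M' : ℝ := max M 1 with hM'
  have hM'1 : 1 ≤ M' := le_max_right _ _
  obtain ⟨s, hs⟩ := hK (ε / (6 * M')) (by positivity)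
  have hs' : ∀ y : E, ‖y‖ ≤ 3 * M' → (∀ φ ∈ s, φ y = 0) → ‖K y‖ ≤ ε / 2 := by
    intro y hy hφ
    have h1 := hs ((3 * M')⁻¹ • y) (by
      rw [norm_smul, Real.norm_of_nonneg (by positivity), inv_mul_le_iff₀ (by positivity)]
      simpa using hy) (fun φ hφs => by rw [map_smul, hφ φ hφs, smul_zero])
    rw [map_smul, norm_smul, Real.norm_of_nonneg (by positivity),
      inv_mul_lt_iff₀ (by positivity)] at h1
    refine h1.le.trans (le_of_eq ?_)
    field_simp
    norm_num
  -- a right inverse `R` of the functionals, viewed as a map `Λr` onto its finite dimensional range,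
  -- corrects vectors that are almost in the kernel
  let Λ : E →L[ℝ] (s → 𝕜) := ContinuousLinearMap.pi fun φ => φ.1
  let Λr : E →L[ℝ] Λ.range := Λ.codRestrict _ fun x => ⟨x, rfl⟩
  have hsurj : Λr.range = ⊤ := by
    rw [LinearMap.range_eq_top]
    rintro ⟨_, x, rfl⟩
    exact ⟨x, rfl⟩
  obtain ⟨R, hR⟩ := Λr.exists_rightInverse_of_surjective hsurj
  have hRa : ∀ z, Λr (R z) = z := fun z => congrArg (fun f => f z) hR
  have htb : TotallyBounded (Λr '' Metric.closedBall 0 M') := by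
    have hb : Bornology.IsBounded (Λr '' Metric.closedBall 0 M') :=
      Λr.lipschitz.isBounded_image Metric.isBounded_closedBall
    have : ProperSpace Λ.range := FiniteDimensional.proper_real _
    exact hb.isCompact_closure.totallyBounded.subset subset_closure
  obtain ⟨η, hη, hη1, hη2⟩ : ∃ η > 0, ‖R‖ * η ≤ 1 ∧ ‖K‖ * (‖R‖ * η) < ε / 2 := by
    have h1 : Tendsto (fun η : ℝ => ‖R‖ * η) (𝓝[>] 0) (𝓝 0) :=
      (Continuous.tendsto' (by fun_prop) 0 0 (by simp)).mono_left nhdsWithin_le_nhds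
    have h2 : Tendsto (fun η : ℝ => ‖K‖ * (‖R‖ * η)) (𝓝[>] 0) (𝓝 0) :=
      (Continuous.tendsto' (by fun_prop) 0 0 (by simp)).mono_left nhdsWithin_le_nhds
    obtain ⟨η, ha, hb, hc⟩ := ((h1.eventually_le_const one_pos).and
      ((h2.eventually_lt_const (half_pos hε)).and self_mem_nhdsWithin)).exists
    exact ⟨η, hc, ha, hb⟩
  obtain ⟨t, htsub, htfin, htcov⟩ :=
    totallyBounded_iff_subset.1 htb _ (Metric.dist_mem_uniformity hη)
  obtain ⟨t', ht'sub, ht'fin, rfl⟩ := Set.exists_subset_image_finite_and.1 ⟨t, htsub, htfin, rfl⟩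
  refine ⟨K '' t', ht'fin.image _, ?_⟩
  rintro _ ⟨y, hy, rfl⟩
  have hyM : ‖y‖ ≤ M' := (mem_closedBall_zero_iff.1 hy).trans (le_max_left _ _)
  have := htcov ⟨y, mem_closedBall_zero_iff.2 hyM, rfl⟩
  simp only [Set.mem_iUnion, Set.mem_image, exists_prop] at this
  obtain ⟨_, ⟨w, hw, rfl⟩, hyw⟩ := this
  have hyw : ‖Λr (y - w)‖ < η := by rw [map_sub, ← dist_eq_norm]; exact hyw
  have hwM : ‖w‖ ≤ M' := mem_closedBall_zero_iff.1 (ht'sub hw)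
  simp only [Set.mem_iUnion, Set.mem_image, exists_prop]
  refine ⟨_, ⟨w, hw, rfl⟩, ?_⟩
  rw [Metric.mem_ball, dist_eq_norm, ← map_sub]
  set c := R (Λr (y - w)) with hc
  have hcn : ‖c‖ ≤ ‖R‖ * η :=
    (R.le_opNorm _).trans (mul_le_mul_of_nonneg_left hyw.le (norm_nonneg _))
  have h1 : ‖K (y - w - c)‖ ≤ ε / 2 := by
    refine hs' _ ?_ fun φ hφ => ?_
    · linarith [norm_sub_le (y - w) c, norm_sub_le y w]
    · have h0 : Λr (y - w - c) = 0 := by rw [map_sub, hc, hRa, sub_self]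
      exact congrFun (congrArg Subtype.val h0) ⟨φ, hφ⟩
  calc ‖K (y - w)‖ = ‖K (y - w - c) + K c‖ := by rw [← map_add, sub_add_cancel]
    _ ≤ ‖K (y - w - c)‖ + ‖K‖ * ‖c‖ := (norm_add_le _ _).trans (by gcongr; exact K.le_opNorm c)
    _ ≤ ε / 2 + ‖K‖ * (‖R‖ * η) := by gcongr
    _ < ε := by linarith

/-- Finitely many functionals of norm at most one suffice to compute the norm on a finite
dimensional subspace up to the factor `1 + ε`, because its unit sphere is compact. -/
theorem exists_finset_norming {𝕜 X : Type*} [RCLike 𝕜] [NormedAddCommGroup X] [NormedSpace 𝕜 X]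
    (W : Submodule 𝕜 X) [FiniteDimensional 𝕜 W] {ε : ℝ} (hε : 0 < ε) :
    ∃ F : Finset (StrongDual 𝕜 X), (∀ φ ∈ F, ‖φ‖ ≤ 1) ∧
      ∀ v ∈ W, ∃ φ ∈ F, ‖v‖ ≤ (1 + ε) * ‖φ v‖ := by
  classical
  have : ProperSpace W := FiniteDimensional.proper_rclike 𝕜 W
  choose φ hφ1 hφ2 using fun x : X => exists_dual_vector'' 𝕜 x
  -- `η` is chosen so that `1 ≤ (1 + ε) * (1 - η)`
  set η : ℝ := ε / (2 * (1 + ε)) with hη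
  have hη0 : 0 < η := by positivity
  obtain ⟨t, htsub, htfin, htcov⟩ := totallyBounded_iff_subset.1
    (isCompact_sphere (0 : W) 1).totallyBounded _ (Metric.dist_mem_uniformity hη0)
  have hnorm : ∀ v : W, ‖v‖ = 1 → ∃ w ∈ t, 1 ≤ (1 + ε) * ‖φ (w : X) v‖ := by
    intro v hv
    have := htcov (mem_sphere_zero_iff_norm.2 hv)
    simp only [Set.mem_iUnion, exists_prop] at this
    obtain ⟨w, hw, hvw⟩ := this
    refine ⟨w, hw, ?_⟩
    have hvw' : ‖(w : X) - v‖ ≤ η := by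
      have : dist v w < η := hvw
      rw [dist_comm, dist_eq_norm] at this
      exact_mod_cast this.le
    have hw1 : ‖(w : X)‖ = 1 := mem_sphere_zero_iff_norm.1 (htsub hw)
    have h1 : ‖φ (w : X) ((w : X) - v)‖ ≤ η :=
      ((φ (w : X)).le_of_opNorm_le (hφ1 _) _).trans (by simpa using hvw')
    have h2 : ‖φ (w : X) (w : X)‖ = 1 := by rw [hφ2, hw1]; simp
    have h3 : 1 - η ≤ ‖φ (w : X) v‖ := by
      rw [map_sub] at h1
      linarith [norm_sub_norm_le (φ (w : X) (w : X)) (φ (w : X) v)]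
    calc (1 : ℝ) ≤ (1 + ε) * (1 - η) := by
          have : (1 + ε) * η = ε / 2 := by rw [hη]; field_simp
          nlinarith
      _ ≤ _ := by gcongr
  -- the functional `0` serves the vector `0`, as the sphere is empty when `W` is trivial
  refine ⟨insert 0 (htfin.toFinset.image fun w => φ (w : X)), ?_, fun v hv => ?_⟩
  · intro ψ hψ
    rcases Finset.mem_insert.1 hψ with rfl | hψ
    · simp
    · obtain ⟨w, -, rfl⟩ := Finset.mem_image.1 hψ
      exact hφ1 _
  · rcases eq_or_ne v 0 with rfl | hv0
    · exact ⟨0, Finset.mem_insert_self _ _, by simp⟩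
    · have hvn : ‖v‖ ≠ 0 := norm_ne_zero_iff.2 hv0
      have hn : ‖((‖v‖⁻¹ : ℝ) : 𝕜)‖ = ‖v‖⁻¹ := by
        rw [RCLike.norm_ofReal, abs_of_nonneg (by positivity)]
      obtain ⟨w, hw, h⟩ := hnorm (((‖v‖⁻¹ : ℝ) : 𝕜) • ⟨v, hv⟩) (by
        rw [norm_smul, hn, Submodule.coe_norm]
        exact inv_mul_cancel₀ hvn)
      refine ⟨φ (w : X), Finset.mem_insert_of_mem (Finset.mem_image_of_mem _
        (by simpa using hw)), ?_⟩
      rw [Submodule.coe_smul, map_smul, norm_smul, hn] at h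
      have h' := mul_le_mul_of_nonneg_left h (norm_nonneg v)
      calc ‖v‖ = ‖v‖ * 1 := (mul_one _).symm
        _ ≤ _ := h'
        _ = _ := by field_simp

/-- A sequence may be chosen term by term, each term subject to a condition that depends only on
the terms before it. -/
theorem exists_seq_of_prefix {α : Type*} [Inhabited α] (P : ℕ → (ℕ → α) → α → Prop)
    (hP : ∀ n g g', (∀ i < n, g i = g' i) → ∀ y, P n g y → P n g' y)
    (h : ∀ n g, ∃ y, P n g y) : ∃ g : ℕ → α, ∀ n, P n g (g n) := by
  classical
  choose y hy using h
  let step : ∀ n : ℕ, (∀ m < n, α) → α := fun n rec =>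
    y n fun i => if hi : i < n then rec i hi else default
  let g : ℕ → α := fun n => WellFounded.fix (C := fun _ => α) Nat.lt_wfRel.wf step n
  have hg : ∀ n, g n = y n fun i => if i < n then g i else default := by
    intro n
    exact WellFounded.fix_eq _ step n
  refine ⟨g, fun n => ?_⟩
  have h1 := hy n fun i => if i < n then g i else default
  rw [← hg] at h1
  exact hP n _ g (fun i hi => by simp [hi]) _ h1

/-! ### Finite dimensional decompositions of closed spans -/

section Decomposition

variable {𝕜 X : Type*} [RCLike 𝕜] [NormedAddCommGroup X] [NormedSpace 𝕜 X]

theorem exists_eventually_sum_eq_of_mem_iSup {V : ℕ → Submodule 𝕜 X} {y : X}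
    (hy : y ∈ ⨆ n, V n) :
    ∃ c : ℕ → X, (∀ i, c i ∈ V i) ∧ ∀ᶠ n in atTop, ∑ i ∈ Finset.range n, c i = y := by
  obtain ⟨f, hf, rfl⟩ := (Submodule.mem_iSup_iff_exists_finsupp V y).1 hy
  refine ⟨f, hf, ?_⟩
  obtain ⟨m, hm⟩ := f.support.exists_nat_subset_range
  filter_upwards [eventually_ge_atTop m] with n hn
  rw [Finsupp.sum]
  refine (Finset.sum_subset (hm.trans (Finset.range_mono hn)) fun i _ hi => ?_).symm
  simpa using hi

/-- The partial sum projections, bounded on the algebraic sum of the `V n`, extend to its closure: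
`P n` below is the limit of the `n`-th partial sums of approximations `u k` of `y`. -/
theorem exists_expansion_of_mem_closure [CompleteSpace X] {V : ℕ → Submodule 𝕜 X}
    (hfd : ∀ n, FiniteDimensional 𝕜 (V n)) {C : ℝ}
    (hV : ∀ v : ℕ → X, (∀ i, v i ∈ V i) → ∀ n m, n ≤ m →
      ‖∑ i ∈ Finset.range n, v i‖ ≤ C * ‖∑ i ∈ Finset.range m, v i‖)
    {y : X} (hy : y ∈ (⨆ n, V n).topologicalClosure) :
    ∃ v : ℕ → X, (∀ i, v i ∈ V i) ∧
      Tendsto (fun n => ∑ i ∈ Finset.range n, v i) atTop (𝓝 y) := by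
  obtain ⟨u, hu, huy⟩ := mem_closure_iff_seq_limit.1 hy
  choose c hc hcu using fun k => exists_eventually_sum_eq_of_mem_iSup (hu k)
  have hbound : ∀ n k l, ‖∑ i ∈ Finset.range n, c k i - ∑ i ∈ Finset.range n, c l i‖ ≤
      C * ‖u k - u l‖ := by
    intro n k l
    obtain ⟨m, ⟨hmk, hml⟩, hnm⟩ :=
      (((hcu k).and (hcu l)).and (eventually_ge_atTop n)).exists
    rw [← hmk, ← hml, ← Finset.sum_sub_distrib, ← Finset.sum_sub_distrib]
    exact hV _ (fun i => (V i).sub_mem (hc k i) (hc l i)) n m hnm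
  have hcauchy : ∀ n, CauchySeq fun k => ∑ i ∈ Finset.range n, c k i := by
    intro n
    rw [Metric.cauchySeq_iff']
    intro η hη
    have h0 : Tendsto (fun p : ℕ × ℕ => C * ‖u p.1 - u p.2‖) atTop (𝓝 0) := by
      have := (((huy.comp tendsto_fst).sub (huy.comp tendsto_snd)).norm).const_mul C
      rw [prod_atTop_atTop_eq] at this
      simpa using! this
    obtain ⟨⟨N, N'⟩, hN⟩ := (h0.eventually_lt_const hη).exists_forall_of_atTop
    refine ⟨max N N', fun k hk => ?_⟩
    rw [dist_eq_norm]
    exact (hbound n _ _).trans_lt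
      (hN (k, max N N') ⟨(le_max_left _ _).trans hk, le_max_right _ _⟩)
  choose P hP using fun n => cauchySeq_tendsto_of_complete (hcauchy n)
  have hv : ∀ n, P (n + 1) - P n ∈ V n := by
    intro n
    have : FiniteDimensional 𝕜 (V n) := hfd n
    refine (V n).closed_of_finiteDimensional.mem_of_tendsto ((hP (n + 1)).sub (hP n))
      (Eventually.of_forall fun k => ?_)
    rw [Finset.sum_range_succ, add_sub_cancel_left]
    exact hc k n
  have hP0 : P 0 = 0 := tendsto_nhds_unique (hP 0) (by simp)
  refine ⟨fun n => P (n + 1) - P n, hv, ?_⟩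
  simp_rw [Finset.sum_range_sub, hP0, sub_zero]
  rw [Metric.tendsto_atTop]
  intro η hη
  have hPb : ∀ n k, ‖∑ i ∈ Finset.range n, c k i - P n‖ ≤ C * ‖u k - y‖ := fun n k =>
    le_of_tendsto_of_tendsto' ((tendsto_const_nhds.sub (hP n)).norm)
      (((tendsto_const_nhds.sub huy).norm).const_mul C) fun l => hbound n k l
  have h0 : Tendsto (fun k => C * ‖u k - y‖ + ‖u k - y‖) atTop (𝓝 0) := by
    have h1 : Tendsto (fun k => ‖u k - y‖) atTop (𝓝 0) := tendsto_iff_norm_sub_tendsto_zero.1 huy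
    simpa using (h1.const_mul C).add h1
  obtain ⟨k, hk⟩ := (h0.eventually_lt_const hη).exists
  obtain ⟨N, hN⟩ := (hcu k).exists_forall_of_atTop
  refine ⟨N, fun n hn => ?_⟩
  have h2 := hPb n k
  rw [hN n hn, norm_sub_rev] at h2
  rw [dist_eq_norm]
  have h3 := norm_sub_le_norm_sub_add_norm_sub (P n) (u k) y
  linarith

/-- A sequence of finite dimensional subspaces of a Banach space whose partial sums satisfy
`‖∑ i < n, v i‖ ≤ C ‖∑ i < m, v i‖` for `n ≤ m` is a finite dimensional decomposition, with
constant at most `C`, of the closed subspace that it spans. -/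
theorem isFDDWithConstantLE_of_norm_sum_le [CompleteSpace X] {V : ℕ → Submodule 𝕜 X}
    (hfd : ∀ n, FiniteDimensional 𝕜 (V n)) {C : ℝ}
    (hV : ∀ v : ℕ → X, (∀ i, v i ∈ V i) → ∀ n m, n ≤ m →
      ‖∑ i ∈ Finset.range n, v i‖ ≤ C * ‖∑ i ∈ Finset.range m, v i‖) :
    IsFDDWithConstantLE
      (fun n => (V n).comap (⨆ n, V n).topologicalClosure.subtype) C := by
  set Y := (⨆ n, V n).topologicalClosure with hY
  have hVY : ∀ n, V n ≤ Y := fun n => (le_iSup V n).trans (Submodule.le_topologicalClosure _)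
  -- an expansion in `Y` is one in `X`
  have hcoe : ∀ (v : (n : ℕ) → (V n).comap Y.subtype) (x : Y),
      IsExpansion (fun n => (V n).comap Y.subtype) v x ↔
        Tendsto (fun N => ∑ n ∈ Finset.range N, ((v n : Y) : X)) atTop (𝓝 (x : X)) := by
    intro v x
    rw [IsExpansion, tendsto_subtype_rng]
    simp
  have hbd : ∀ (v : ℕ → X), (∀ i, v i ∈ V i) → ∀ x : X,
      Tendsto (fun N => ∑ n ∈ Finset.range N, v n) atTop (𝓝 x) →
      ∀ N, ‖∑ n ∈ Finset.range N, v n‖ ≤ C * ‖x‖ := by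
    intro v hv x hx N
    refine ge_of_tendsto (hx.norm.const_mul C) ?_
    filter_upwards [eventually_ge_atTop N] with m hm using hV v hv N m hm
  refine { finiteDimensional := fun n => ?_, existsUnique_expansion := fun x => ?_,
           norm_partialSum_le := fun v x hvx N => ?_ }
  · have : FiniteDimensional 𝕜 (V n) := hfd n
    exact (Submodule.comapSubtypeEquivOfLe (hVY n)).symm.finiteDimensional
  · obtain ⟨v, hv, hvx⟩ := exists_expansion_of_mem_closure hfd hV x.2
    refine ⟨fun n => ⟨⟨v n, hVY n (hv n)⟩, hv n⟩, (hcoe _ _).2 hvx, fun w hw => ?_⟩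
    have h0 := hbd (fun n => ((w n : Y) : X) - v n) (fun n => (V n).sub_mem (w n).2 (hv n)) 0
      (by simpa using! ((hcoe w x).1 hw).sub hvx)
    have h1 : ∀ N, ∑ n ∈ Finset.range N, (((w n : Y) : X) - v n) = 0 := fun N =>
      norm_le_zero_iff.1 (by simpa using h0 N)
    funext n
    apply Subtype.ext
    apply Subtype.ext
    have h2 := h1 (n + 1)
    rw [Finset.sum_range_succ, h1 n, zero_add] at h2
    exact sub_eq_zero.1 h2
  · simpa using hbd (fun n => ((v n : Y) : X)) (fun n => (v n).2) x ((hcoe v x).1 hvx) N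

end Decomposition

/-! ### Uniform absolute continuity of weakly null sequences in `L¹` -/

section UniformIntegrability

variable {α 𝕜 : Type*} [MeasurableSpace α] {μ : Measure α} [RCLike 𝕜]

/-- Multiplication by the indicator function of a measurable set, as an operator on `L¹`. -/
noncomputable def indicatorLOne (μ : Measure α) (𝕜 : Type*) [RCLike 𝕜] {B : Set α}
    (hB : MeasurableSet B) : Lp 𝕜 1 μ →L[𝕜] Lp 𝕜 1 μ :=
  LinearMap.mkContinuous
    { toFun := fun u => ((Lp.memLp u).indicator hB).toLp
      map_add' := fun u v => by
        rw [← MemLp.toLp_add]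
        refine MemLp.toLp_congr _ _ ?_
        filter_upwards [Lp.coeFn_add u v] with x hx
        by_cases h : x ∈ B
        · simpa [h] using hx
        · simp [h]
      map_smul' := fun c u => by
        rw [RingHom.id_apply, ← MemLp.toLp_const_smul]
        refine MemLp.toLp_congr _ _ ?_
        filter_upwards [Lp.coeFn_smul c u] with x hx
        by_cases h : x ∈ B
        · simpa [h] using hx
        · simp [h] }
    1 fun u => by
      rw [one_mul]
      refine Lp.norm_le_norm_of_ae_le ?_
      filter_upwards [((Lp.memLp u).indicator hB).coeFn_toLp] with x hx
      simp only [LinearMap.coe_mk, AddHom.coe_mk]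
      rw [hx]
      exact norm_indicator_le_norm_self _ _

theorem coeFn_indicatorLOne {B : Set α} (hB : MeasurableSet B) (u : Lp 𝕜 1 μ) :
    indicatorLOne μ 𝕜 hB u =ᵐ[μ] B.indicator u :=
  ((Lp.memLp u).indicator hB).coeFn_toLp

theorem norm_indicatorLOne_eq {B : Set α} (hB : MeasurableSet B) (u : Lp 𝕜 1 μ) :
    ‖indicatorLOne μ 𝕜 hB u‖ = ∫ x in B, ‖u x‖ ∂μ := by
  rw [L1.norm_eq_integral_norm, ← integral_indicator hB]
  refine integral_congr_ae ?_
  filter_upwards [coeFn_indicatorLOne hB u] with x hx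
  rw [hx, norm_indicator_eq_indicator_norm]

theorem norm_indicatorLOne_compl_add {B : Set α} (hB : MeasurableSet B) (u : Lp 𝕜 1 μ) :
    ‖indicatorLOne μ 𝕜 hB.compl u‖ + ‖indicatorLOne μ 𝕜 hB u‖ = ‖u‖ := by
  rw [norm_indicatorLOne_eq, norm_indicatorLOne_eq, L1.norm_eq_integral_norm, add_comm,
    integral_add_compl hB (L1.integrable_coeFn u).norm]

theorem indicatorLOne_compl_add {B : Set α} (hB : MeasurableSet B) (u : Lp 𝕜 1 μ) :
    indicatorLOne μ 𝕜 hB.compl u + indicatorLOne μ 𝕜 hB u = u := by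
  refine Lp.ext ?_
  filter_upwards [Lp.coeFn_add (indicatorLOne μ 𝕜 hB.compl u) (indicatorLOne μ 𝕜 hB u),
    coeFn_indicatorLOne hB u, coeFn_indicatorLOne hB.compl u] with x h1 h2 h3
  rw [h1, Pi.add_apply, h2, h3]
  exact Set.indicator_compl_add_self_apply B u x

/-- A weakly null sequence in `L¹` is uniformly absolutely continuous, up to finitely many terms.
The proof applies the Baire category theorem to the dual unit ball, which is weak-* compact:
a functional on which the sequence is uniformly small may be modified at will on sets of small
measure, so that it norms the restrictions of the `u n` to such sets. -/
theorem exists_norm_indicatorLOne_le [IsFiniteMeasure μ] {u : ℕ → Lp 𝕜 1 μ}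
    (hu : ∀ φ : StrongDual 𝕜 (Lp 𝕜 1 μ), Tendsto (fun n => φ (u n)) atTop (𝓝 0))
    {η : ℝ} (hη : 0 < η) :
    ∃ k : ℕ, ∃ r > 0, ∀ n ≥ k, ∀ (B : Set α) (hB : MeasurableSet B), μ.real B ≤ r →
      ‖indicatorLOne μ 𝕜 hB (u n)‖ ≤ η := by
  let D : Set (WeakDual 𝕜 (Lp 𝕜 1 μ)) := WeakDual.toStrongDual ⁻¹' Metric.closedBall 0 1
  have hD : CompactSpace D := isCompact_iff_compactSpace.1 (WeakDual.isCompact_closedBall 0 1)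
  let F : ℕ → Set D := fun k => {φ | ∀ n ≥ k, ‖φ.1 (u n)‖ ≤ η}
  have hFc : ∀ k, IsClosed (F k) := by
    intro k
    have : F k = ⋂ n ≥ k, {φ : D | ‖φ.1 (u n)‖ ≤ η} := by ext; simp [F]
    rw [this]
    exact isClosed_biInter fun n _ => isClosed_le
      (((WeakDual.eval_continuous (u n)).comp continuous_subtype_val).norm) continuous_const
  have hFu : ⋃ k, F k = Set.univ := by
    refine Set.eq_univ_of_forall fun φ => Set.mem_iUnion.2 ?_
    have h := (hu (WeakDual.toStrongDual φ.1)).norm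
    rw [norm_zero] at h
    obtain ⟨k, hk⟩ := (h.eventually_le_const hη).exists_forall_of_atTop
    exact ⟨k, hk⟩
  have : Nonempty D := ⟨⟨0, by simp [D]⟩⟩
  obtain ⟨k, φ₀, hφ₀⟩ := nonempty_interior_of_iUnion_of_closed hFc hFu
  refine ⟨k, ?_⟩
  by_contra! hcon
  choose n hnk B hB hBr hlt using fun j : ℕ => hcon (1 / ((j : ℝ) + 1)) (by positivity)
  have hB0 : Tendsto (fun j => μ (B j)) atTop (𝓝 0) := by
    have h1 : Tendsto (fun j => μ.real (B j)) atTop (𝓝 0) :=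
      squeeze_zero (fun _ => measureReal_nonneg) hBr tendsto_one_div_add_atTop_nhds_zero_nat
    rw [← ENNReal.tendsto_toReal_iff (fun _ => measure_ne_top _ _) ENNReal.zero_ne_top]
    simpa [measureReal_def] using h1
  have hsmall : ∀ h : Lp 𝕜 1 μ,
      Tendsto (fun j => ‖indicatorLOne μ 𝕜 (hB j) h‖) atTop (𝓝 0) := by
    intro h
    simp_rw [norm_indicatorLOne_eq]
    exact (L1.integrable_coeFn h).norm.tendsto_setIntegral_nhds_zero hB0
  set φ : StrongDual 𝕜 (Lp 𝕜 1 μ) := WeakDual.toStrongDual φ₀.1 with hφ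
  have hφ1 : ‖φ‖ ≤ 1 := mem_closedBall_zero_iff.1 φ₀.2
  have key : ∀ ψ : ℕ → StrongDual 𝕜 (Lp 𝕜 1 μ), (∀ j, ‖ψ j‖ ≤ 1) → ∀ᶠ j in atTop,
      ‖φ (indicatorLOne μ 𝕜 (hB j).compl (u (n j))) +
        ψ j (indicatorLOne μ 𝕜 (hB j) (u (n j)))‖ ≤ η := by
    intro ψ hψ
    let χ : ℕ → StrongDual 𝕜 (Lp 𝕜 1 μ) := fun j =>
      φ ∘L indicatorLOne μ 𝕜 (hB j).compl + ψ j ∘L indicatorLOne μ 𝕜 (hB j)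
    have hχ : ∀ j, ‖χ j‖ ≤ 1 := fun j =>
      ContinuousLinearMap.opNorm_le_bound _ zero_le_one fun h => by
        rw [one_mul, ← norm_indicatorLOne_compl_add (hB j) h]
        refine (norm_add_le _ _).trans (add_le_add ?_ ?_)
        · simpa using φ.le_of_opNorm_le hφ1 (indicatorLOne μ 𝕜 (hB j).compl h)
        · simpa using (ψ j).le_of_opNorm_le (hψ j) (indicatorLOne μ 𝕜 (hB j) h)
    let χ' : ℕ → D := fun j => ⟨StrongDual.toWeakDual (χ j), by simpa [D] using hχ j⟩
    have hlim : Tendsto χ' atTop (𝓝 φ₀) := by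
      rw [tendsto_subtype_rng, tendsto_iff_forall_eval_tendsto_topDualPairing]
      intro h
      change Tendsto (fun j => χ j h) atTop (𝓝 (φ h))
      rw [tendsto_iff_norm_sub_tendsto_zero]
      refine squeeze_zero (fun _ => norm_nonneg _) (fun j => ?_)
        (by simpa using (hsmall h).const_mul 2)
      have e : χ j h - φ h =
          ψ j (indicatorLOne μ 𝕜 (hB j) h) - φ (indicatorLOne μ 𝕜 (hB j) h) := by
        have e1 : φ h = φ (indicatorLOne μ 𝕜 (hB j).compl h) + φ (indicatorLOne μ 𝕜 (hB j) h) := by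
          rw [← map_add, indicatorLOne_compl_add]
        rw [e1]
        simp only [χ, add_apply, ContinuousLinearMap.comp_apply]
        ring
      rw [e, two_mul]
      refine (norm_sub_le _ _).trans (add_le_add ?_ ?_)
      · simpa using (ψ j).le_of_opNorm_le (hψ j) (indicatorLOne μ 𝕜 (hB j) h)
      · simpa using φ.le_of_opNorm_le hφ1 (indicatorLOne μ 𝕜 (hB j) h)
    filter_upwards [hlim.eventually (mem_interior_iff_mem_nhds.1 hφ₀)] with j hj
    exact hj (n j) (hnk j)
  choose ψ hψ1 hψ2 using fun j => exists_dual_vector'' 𝕜 (indicatorLOne μ 𝕜 (hB j) (u (n j)))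
  obtain ⟨j, hj1, hj2⟩ :=
    ((key ψ hψ1).and (key (fun j => -ψ j) fun j => by simpa using hψ1 j)).exists
  have h2 : ‖(2 : 𝕜) * ψ j (indicatorLOne μ 𝕜 (hB j) (u (n j)))‖ ≤ 2 * η := by
    refine le_trans (le_of_eq ?_) ((norm_sub_le _ _).trans (add_le_add hj1 hj2) |>.trans
      (two_mul η).symm.le)
    congr 1
    simp only [neg_apply]
    ring
  rw [hψ2, norm_mul, RCLike.norm_ofReal, abs_norm, RCLike.norm_two] at h2
  linarith [hlt j]

end UniformIntegrability

/-! ### Compactness on the continuous functions implies complete continuity -/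

section CompactOnContinuous

/-- The inclusion of the real continuous functions in `L¹[0,1]`. -/
noncomputable def continuousToLOne (𝕜 : Type*) [RCLike 𝕜] : C(unitInterval, ℝ) →L[ℝ] LOne 𝕜 :=
  (ContinuousMap.toLp 1 volume ℝ : C(unitInterval, 𝕜) →L[ℝ] LOne 𝕜) ∘L
    (RCLike.ofRealCLM : ℝ →L[ℝ] 𝕜).compLeftContinuous ℝ unitInterval

variable {𝕜 : Type*} [RCLike 𝕜]

theorem coeFn_continuousToLOne (c : C(unitInterval, ℝ)) :
    continuousToLOne 𝕜 c =ᵐ[volume] fun t => ((c t : ℝ) : 𝕜) :=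
  ContinuousMap.coeFn_toLp (𝕜 := ℝ) volume
    ((RCLike.ofRealCLM : ℝ →L[ℝ] 𝕜).compLeftContinuous ℝ unitInterval c)

theorem abs_clamp_le {M : ℝ} (hM : 0 ≤ M) (x : ℝ) : |max (-M) (min x M)| ≤ M :=
  abs_le.2 ⟨le_max_left _ _, max_le (by linarith) (min_le_right _ _)⟩

/-- Clamping `y` to `[-M, M]` does not increase its distance to the points of that interval. -/
theorem abs_sub_clamp_le {M x y : ℝ} (hx : |x| ≤ M) : |x - max (-M) (min y M)| ≤ |x - y| := by
  obtain ⟨h1, h2⟩ := abs_le.1 hx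
  rcases le_total y M with h | h
  · rw [min_eq_left h]
    rcases le_total (-M) y with h' | h'
    · rw [max_eq_right h']
    · rw [max_eq_left h', abs_of_nonneg (by linarith), abs_of_nonneg (by linarith)]
      linarith
  · rw [min_eq_right h, max_eq_right (by linarith), abs_of_nonpos (by linarith),
      abs_of_nonpos (by linarith)]
    linarith

/-- A bounded element of `L¹[0,1]` is a norm limit of continuous functions whose real and imaginary
parts have the same bound. -/
theorem exists_continuous_norm_sub_le {M : ℝ} (hM : 0 ≤ M) {v : LOne 𝕜}
    (hv : ∀ᵐ t, ‖v t‖ ≤ M) {η : ℝ} (hη : 0 < η) :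
    ∃ c₁ c₂ : C(unitInterval, ℝ), ‖c₁‖ ≤ M ∧ ‖c₂‖ ≤ M ∧
      ‖v - (continuousToLOne 𝕜 c₁ + (RCLike.I : 𝕜) • continuousToLOne 𝕜 c₂)‖ ≤ 2 * η := by
  obtain ⟨_, ⟨c, rfl⟩, hc⟩ := Metric.mem_closure_iff.1
    (ContinuousMap.toLp_denseRange 𝕜 (volume : Measure unitInterval) 𝕜 ENNReal.one_ne_top v) η hη
  let c₁ : C(unitInterval, ℝ) := ⟨fun t => max (-M) (min (RCLike.re (c t)) M), by fun_prop⟩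
  let c₂ : C(unitInterval, ℝ) := ⟨fun t => max (-M) (min (RCLike.im (c t)) M), by fun_prop⟩
  refine ⟨c₁, c₂, (ContinuousMap.norm_le _ hM).2 fun t => abs_clamp_le hM _,
    (ContinuousMap.norm_le _ hM).2 fun t => abs_clamp_le hM _, ?_⟩
  refine (Lp.norm_le_mul_norm_of_ae_le_mul
    (g := v - ContinuousMap.toLp 1 volume 𝕜 c) (c := 2) ?_).trans (by
      rw [dist_eq_norm] at hc; gcongr)
  filter_upwards [hv, Lp.coeFn_sub v (ContinuousMap.toLp 1 volume 𝕜 c),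
    ContinuousMap.coeFn_toLp (p := 1) (𝕜 := 𝕜) volume c,
    Lp.coeFn_sub v (continuousToLOne 𝕜 c₁ + (RCLike.I : 𝕜) • continuousToLOne 𝕜 c₂),
    Lp.coeFn_add (continuousToLOne 𝕜 c₁) ((RCLike.I : 𝕜) • continuousToLOne 𝕜 c₂),
    Lp.coeFn_smul (RCLike.I : 𝕜) (continuousToLOne 𝕜 c₂),
    coeFn_continuousToLOne (𝕜 := 𝕜) c₁, coeFn_continuousToLOne (𝕜 := 𝕜) c₂]
    with t h1 h2 h3 h4 h5 h6 h7 h8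
  rw [h2, h4, Pi.sub_apply, Pi.sub_apply, h3, h5, Pi.add_apply, h6, Pi.smul_apply, h7, h8]
  have e : v t - ((c₁ t : 𝕜) + (RCLike.I : 𝕜) • (c₂ t : 𝕜)) =
      ((RCLike.re (v t) - c₁ t : ℝ) : 𝕜) + ((RCLike.im (v t) - c₂ t : ℝ) : 𝕜) * RCLike.I := by
    conv_lhs => rw [← RCLike.re_add_im (v t)]
    push_cast
    rw [smul_eq_mul]
    ring
  -- `RCLike.I` is zero when `𝕜 = ℝ`
  have hI : ‖(RCLike.I : 𝕜)‖ ≤ 1 := by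
    rcases RCLike.I_eq_zero_or_im_I_eq_one (K := 𝕜) with h | h
    · simp [h]
    · exact (RCLike.norm_I_of_ne_zero (fun h0 => by simp [h0] at h)).le
  calc ‖v t - ((c₁ t : 𝕜) + (RCLike.I : 𝕜) • (c₂ t : 𝕜))‖
      ≤ |RCLike.re (v t) - c₁ t| + |RCLike.im (v t) - c₂ t| * 1 := by
        rw [e]
        refine (norm_add_le _ _).trans ?_
        rw [norm_mul, RCLike.norm_ofReal, RCLike.norm_ofReal]
        gcongr
    _ ≤ |RCLike.re (v t - c t)| + |RCLike.im (v t - c t)| := by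
        rw [map_sub, map_sub, mul_one]
        exact add_le_add (abs_sub_clamp_le ((RCLike.abs_re_le_norm _).trans h1))
          (abs_sub_clamp_le ((RCLike.abs_im_le_norm _).trans h1))
    _ ≤ 2 * ‖v t - c t‖ := by
        linarith [RCLike.abs_re_le_norm (v t - c t), RCLike.abs_im_le_norm (v t - c t)]

theorem exists_norm_le_of_weakly_null {E : Type*} [NormedAddCommGroup E] [NormedSpace 𝕜 E]
    {u : ℕ → E} (hu : ∀ φ : StrongDual 𝕜 E, Tendsto (fun n => φ (u n)) atTop (𝓝 0)) :
    ∃ C, ∀ n, ‖u n‖ ≤ C := by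
  obtain ⟨C, hC⟩ := banach_steinhaus (g := fun n => NormedSpace.inclusionInDoubleDualLi 𝕜 (u n))
    fun φ => by
      obtain ⟨C, hC⟩ := (Metric.isBounded_range_of_tendsto _ (hu φ)).exists_norm_le
      exact ⟨C, fun n => hC _ ⟨n, rfl⟩⟩
  exact ⟨C, fun n => by
    simpa only [LinearIsometry.norm_map] using hC n⟩

variable {X : Type*} [NormedAddCommGroup X] [NormedSpace 𝕜 X] [NormedSpace ℝ X]
  [IsScalarTower ℝ 𝕜 X]

/-- The restriction of an operator on `L¹[0,1]` to the real continuous functions. -/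
noncomputable def restrictContinuous (T : LOne 𝕜 →L[𝕜] X) : C(unitInterval, ℝ) →L[ℝ] X :=
  (T.restrictScalars ℝ) ∘L continuousToLOne 𝕜

theorem restrictContinuous_apply (T : LOne 𝕜 →L[𝕜] X) (c : C(unitInterval, ℝ)) :
    restrictContinuous T c = T (continuousToLOne 𝕜 c) := rfl

open scoped Pointwise in
/-- An operator on `L¹[0,1]` is completely continuous as soon as it is compact on the continuous
functions with the supremum norm: weakly null sequences in `L¹` being uniformly integrable, they
are close in norm to bounded sequences. -/
theorem isCompletelyContinuous_of_totallyBounded [CompleteSpace X] (T : LOne 𝕜 →L[𝕜] X)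
    (hT : ∀ M, TotallyBounded (restrictContinuous T '' Metric.closedBall 0 M)) :
    IsCompletelyContinuous T := by
  -- it is enough to consider weakly null sequences
  suffices H : ∀ u : ℕ → LOne 𝕜,
      (∀ φ : StrongDual 𝕜 (LOne 𝕜), Tendsto (fun n => φ (u n)) atTop (𝓝 0)) →
      Tendsto (fun n => T (u n)) atTop (𝓝 0) by
    intro u f huf
    rw [tendsto_toWeakSpace_iff] at huf
    have := H (fun n => u n - f) fun φ => by
      simpa using (huf φ).sub_const (φ f)
    simp_rw [map_sub] at this
    exact tendsto_sub_nhds_zero_iff.1 this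
  intro u hu
  refine tendsto_zero_of_totallyBounded_of_weak (𝕜 := 𝕜) ?_ fun φ => hu (φ ∘L T)
  obtain ⟨C, hC⟩ := exists_norm_le_of_weakly_null hu
  rw [Metric.totallyBounded_iff]
  intro ε hε
  obtain ⟨η, hη, hηε⟩ : ∃ η > 0, ‖T‖ * (3 * η) < ε / 2 := by
    have h1 : Tendsto (fun η : ℝ => ‖T‖ * (3 * η)) (𝓝[>] 0) (𝓝 0) :=
      (Continuous.tendsto' (by fun_prop) 0 0 (by simp)).mono_left nhdsWithin_le_nhds
    obtain ⟨η, ha, hb⟩ :=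
      ((h1.eventually_lt_const (half_pos hε)).and self_mem_nhdsWithin).exists
    exact ⟨η, hb, ha⟩
  obtain ⟨k, r, hr, hk⟩ := exists_norm_indicatorLOne_le hu hη
  -- by Markov's inequality, `{t | M + 1 ≤ ‖u n t‖}` has measure at most `r`
  set M : ℝ := max C 0 / r with hM
  have hM0 : 0 ≤ M := by positivity
  have happrox : ∀ n ≥ k, ∃ c₁ c₂ : C(unitInterval, ℝ), ‖c₁‖ ≤ M + 1 ∧ ‖c₂‖ ≤ M + 1 ∧
      ‖u n - (continuousToLOne 𝕜 c₁ + (RCLike.I : 𝕜) • continuousToLOne 𝕜 c₂)‖ ≤ 3 * η := by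
    intro n hn
    set B : Set unitInterval := {t | M + 1 ≤ ‖u n t‖} with hB
    have hBm : MeasurableSet B :=
      measurableSet_le measurable_const (Lp.stronglyMeasurable (u n)).norm.measurable
    have hBr : volume.real B ≤ r := by
      have h1 := mul_meas_ge_le_integral_of_nonneg (μ := volume)
        (Eventually.of_forall fun t => norm_nonneg (u n t)) (L1.integrable_coeFn (u n)).norm (M + 1)
      rw [← L1.norm_eq_integral_norm] at h1
      have h2 : (M + 1) * volume.real B ≤ M * r := by
        refine h1.trans ((hC n).trans ?_)
        rw [hM, div_mul_cancel₀ _ hr.ne']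
        exact le_max_left _ _
      have h3 : (M + 1) * volume.real B ≤ (M + 1) * r := by linarith
      exact le_of_mul_le_mul_left h3 (by linarith)
    have h1 := hk n hn B hBm hBr
    obtain ⟨c₁, c₂, hc₁, hc₂, hc⟩ := exists_continuous_norm_sub_le (M := M + 1) (by linarith)
      (v := indicatorLOne volume 𝕜 hBm.compl (u n)) (by
        filter_upwards [coeFn_indicatorLOne hBm.compl (u n)] with t ht
        rw [ht]
        by_cases h : t ∈ B
        · simp only [Set.mem_compl_iff, h, not_true_eq_false, not_false_eq_true,
            Set.indicator_of_notMem, norm_zero]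
          linarith
        · rw [Set.indicator_of_mem (by simpa using h)]
          exact (not_le.1 h).le) hη
    refine ⟨c₁, c₂, hc₁, hc₂, ?_⟩
    have e := indicatorLOne_compl_add hBm (u n)
    set w := continuousToLOne 𝕜 c₁ + (RCLike.I : 𝕜) • continuousToLOne 𝕜 c₂
    calc ‖u n - w‖ = ‖(indicatorLOne volume 𝕜 hBm.compl (u n) - w) +
          indicatorLOne volume 𝕜 hBm (u n)‖ := by
            conv_lhs => rw [← e]
            congr 1
            abel
      _ ≤ 2 * η + η := (norm_add_le _ _).trans (add_le_add hc h1)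
      _ = 3 * η := by ring
  have hcl : IsCompact (closure (restrictContinuous T '' Metric.closedBall 0 (M + 1))) :=
    isCompact_iff_totallyBounded_isComplete.2 ⟨(hT _).closure, isClosed_closure.isComplete⟩
  have htb := (hcl.add (hcl.image (continuous_const_smul (RCLike.I : 𝕜)))).totallyBounded
  obtain ⟨t, htf, ht⟩ := Metric.totallyBounded_iff.1 htb (ε / 2) (half_pos hε)
  refine ⟨t ∪ (fun n => T (u n)) '' Set.Iio k, htf.union ((Set.finite_Iio k).image _), ?_⟩
  rintro _ ⟨n, rfl⟩
  simp only [Set.mem_iUnion, exists_prop]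
  rcases lt_or_ge n k with hn | hn
  · exact ⟨T (u n), Or.inr ⟨n, hn, rfl⟩, Metric.mem_ball_self hε⟩
  obtain ⟨c₁, c₂, hc₁, hc₂, hc⟩ := happrox n hn
  have hmem : T (continuousToLOne 𝕜 c₁ + (RCLike.I : 𝕜) • continuousToLOne 𝕜 c₂) ∈
      closure (restrictContinuous T '' Metric.closedBall 0 (M + 1)) +
        (fun x => (RCLike.I : 𝕜) • x) ''
          closure (restrictContinuous T '' Metric.closedBall 0 (M + 1)) := by
    rw [map_add, map_smul]
    exact Set.add_mem_add (subset_closure ⟨c₁, by simpa using hc₁, rfl⟩)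
      ⟨_, subset_closure ⟨c₂, by simpa using hc₂, rfl⟩, rfl⟩
  have := ht hmem
  simp only [Set.mem_iUnion, exists_prop] at this
  obtain ⟨x, hx, hxd⟩ := this
  refine ⟨x, Or.inl hx, ?_⟩
  rw [Metric.mem_ball, dist_eq_norm] at hxd ⊢
  have h1 : ‖T (u n) - T (continuousToLOne 𝕜 c₁ + (RCLike.I : 𝕜) • continuousToLOne 𝕜 c₂)‖
      ≤ ‖T‖ * (3 * η) := by
    rw [← map_sub]
    exact (T.le_opNorm _).trans (by gcongr)
  have h2 := norm_sub_le_norm_sub_add_norm_sub (T (u n))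
    (T (continuousToLOne 𝕜 c₁ + (RCLike.I : 𝕜) • continuousToLOne 𝕜 c₂)) x
  linarith

end CompactOnContinuous

/-! ### Dyadic, Rademacher and Walsh functions -/

section Dyadic

/-- A function on `[0,1]` is dyadic of level `m` if it depends only on the integer part of
`2 ^ m * t`, that is, on the first `m` binary digits of `t` (up to the value at `1`). -/
def IsDyadic {F : Type*} (m : ℕ) (f : unitInterval → F) : Prop :=
  ∃ G : ℕ → F, ∀ t, f t = G ⌊(2 : ℝ) ^ m * t⌋₊

variable {F : Type*}

theorem IsDyadic.const (m : ℕ) (c : F) : IsDyadic m fun _ => c := ⟨fun _ => c, fun _ => rfl⟩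

theorem IsDyadic.comp₂ {F₁ F₂ : Type*} {m : ℕ} {f : unitInterval → F₁} {g : unitInterval → F₂}
    (hf : IsDyadic m f) (hg : IsDyadic m g) (op : F₁ → F₂ → F) :
    IsDyadic m fun t => op (f t) (g t) := by
  obtain ⟨G, hG⟩ := hf
  obtain ⟨H, hH⟩ := hg
  exact ⟨fun k => op (G k) (H k), fun t => by simp only [hG, hH]⟩

theorem IsDyadic.comp {F₁ : Type*} {m : ℕ} {f : unitInterval → F₁} (hf : IsDyadic m f)
    (op : F₁ → F) : IsDyadic m fun t => op (f t) :=
  hf.comp₂ hf fun x _ => op x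

theorem floor_two_pow_mul_div {m n : ℕ} (h : m ≤ n) (x : ℝ) :
    ⌊(2 : ℝ) ^ m * x⌋₊ = ⌊(2 : ℝ) ^ n * x⌋₊ / 2 ^ (n - m) := by
  rw [← Nat.floor_div_natCast]
  congr 1
  obtain ⟨k, rfl⟩ := Nat.exists_eq_add_of_le h
  rw [Nat.add_sub_cancel_left, pow_add]
  push_cast
  field_simp

theorem IsDyadic.mono {m n : ℕ} (h : m ≤ n) {f : unitInterval → F} (hf : IsDyadic m f) :
    IsDyadic n f := by
  obtain ⟨G, hG⟩ := hf
  exact ⟨fun k => G (k / 2 ^ (n - m)), fun t => by rw [hG, floor_two_pow_mul_div h]⟩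

theorem IsDyadic.measurable [MeasurableSpace F] {m : ℕ} {f : unitInterval → F}
    (hf : IsDyadic m f) : Measurable f := by
  obtain ⟨G, hG⟩ := hf
  rw [funext hG]
  exact measurable_from_top.comp
    (Nat.measurable_floor.comp (measurable_const.mul measurable_subtype_coe))

theorem floor_two_pow_mul_le (m : ℕ) (t : unitInterval) : ⌊(2 : ℝ) ^ m * t⌋₊ ≤ 2 ^ m := by
  refine Nat.floor_le_of_le ?_
  push_cast
  exact mul_le_of_le_one_right (by positivity) t.2.2

theorem IsDyadic.exists_norm_le [NormedAddCommGroup F] {m : ℕ} {f : unitInterval → F}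
    (hf : IsDyadic m f) : ∃ C, ∀ t, ‖f t‖ ≤ C := by
  obtain ⟨G, hG⟩ := hf
  refine ⟨∑ k ∈ Finset.range (2 ^ m + 1), ‖G k‖, fun t => ?_⟩
  rw [hG]
  exact Finset.single_le_sum (f := fun k => ‖G k‖) (fun _ _ => norm_nonneg _)
    (Finset.mem_range.2 (Nat.lt_succ_of_le (floor_two_pow_mul_le m t)))

theorem IsDyadic.memLp {𝕜 : Type*} [RCLike 𝕜] {m : ℕ} {f : unitInterval → 𝕜}
    (hf : IsDyadic m f) (p : ENNReal) : MemLp f p (volume : Measure unitInterval) := by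
  obtain ⟨C, hC⟩ := hf.exists_norm_le
  exact MemLp.of_bound hf.measurable.aestronglyMeasurable C (Eventually.of_forall hC)

theorem IsDyadic.integrable {𝕜 : Type*} [RCLike 𝕜] {m : ℕ} {f : unitInterval → 𝕜}
    (hf : IsDyadic m f) : Integrable f (volume : Measure unitInterval) :=
  memLp_one_iff_integrable.1 (hf.memLp 1)

theorem exists_isDyadic_norm_sub_le [NormedAddCommGroup F] (c : C(unitInterval, F)) {η : ℝ}
    (hη : 0 < η) : ∃ m, ∃ h : unitInterval → F, IsDyadic m h ∧ ∀ t, ‖c t - h t‖ ≤ η := by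
  obtain ⟨δ, hδ, hc⟩ := Metric.uniformContinuous_iff.1
    (CompactSpace.uniformContinuous_of_continuous c.continuous) η hη
  obtain ⟨m, hm⟩ := exists_pow_lt_of_lt_one hδ (one_half_lt_one (α := ℝ))
  refine ⟨m, _, ⟨fun k => c (Set.projIcc 0 1 zero_le_one ((k : ℝ) / 2 ^ m)), fun _ => rfl⟩,
    fun t => ?_⟩
  rw [← dist_eq_norm]
  refine (hc (lt_of_le_of_lt ?_ hm)).le
  have h2 : (0 : ℝ) < 2 ^ m := by positivity
  have hle : (⌊(2 : ℝ) ^ m * t⌋₊ : ℝ) ≤ 2 ^ m * t :=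
    Nat.floor_le (mul_nonneg h2.le t.2.1)
  have hlt := Nat.lt_floor_add_one ((2 : ℝ) ^ m * t)
  have hmem : (⌊(2 : ℝ) ^ m * t⌋₊ : ℝ) / 2 ^ m ∈ Set.Icc (0 : ℝ) 1 :=
    ⟨by positivity, by rw [div_le_one h2]; exact hle.trans (mul_le_of_le_one_right h2.le t.2.2)⟩
  rw [Set.projIcc_of_mem _ hmem, Subtype.dist_eq, Real.dist_eq, one_div, inv_pow]
  have e : (t : ℝ) - (⌊(2 : ℝ) ^ m * t⌋₊ : ℝ) / 2 ^ m =
      (2 ^ m * t - ⌊(2 : ℝ) ^ m * t⌋₊) * (2 ^ m)⁻¹ := by field_simp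
  rw [e, abs_of_nonneg (mul_nonneg (by linarith) (by positivity))]
  exact mul_le_of_le_one_left (by positivity) (by linarith)

variable [NormedAddCommGroup F] [NormedSpace ℝ F]

theorem intervalIntegral_floor [CompleteSpace F] (G : ℕ → F) (N : ℕ) :
    ∫ s in (0 : ℝ)..N, G ⌊s⌋₊ = ∑ k ∈ Finset.range N, G k := by
  have hae : ∀ k : ℕ, (fun s : ℝ => G ⌊s⌋₊) =ᵐ[volume.restrict (Set.Ioc (k : ℝ) (k + 1 : ℕ))]
      fun _ => G k := by
    intro k
    rw [← restrict_Ioo_eq_restrict_Ioc]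
    refine (ae_restrict_mem measurableSet_Ioo).mono fun s hs => ?_
    have : ⌊s⌋₊ = k := (Nat.floor_eq_iff (k.cast_nonneg.trans hs.1.le)).2
      ⟨hs.1.le, by exact_mod_cast hs.2⟩
    simp only [this]
  have hle : ∀ k : ℕ, (k : ℝ) ≤ (k + 1 : ℕ) := fun k => by exact_mod_cast k.le_succ
  have h1 := intervalIntegral.sum_integral_adjacent_intervals (μ := volume)
    (f := fun s : ℝ => G ⌊s⌋₊) (a := fun k : ℕ => (k : ℝ)) (n := N) fun k _ => by
      rw [intervalIntegrable_iff_integrableOn_Ioc_of_le (hle k)]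
      exact (integrable_congr (hae k)).2 (integrable_const _)
  rw [Nat.cast_zero] at h1
  rw [← h1]
  refine Finset.sum_congr rfl fun k _ => ?_
  rw [intervalIntegral.integral_of_le (hle k), integral_congr_ae (hae k)]
  simp

theorem integral_floor_two_pow [CompleteSpace F] (G : ℕ → F) (m : ℕ) :
    ∫ t : unitInterval, G ⌊(2 : ℝ) ^ m * t⌋₊ =
      ((2 : ℝ) ^ m)⁻¹ • ∑ k ∈ Finset.range (2 ^ m), G k := by
  rw [unitInterval.volume_def,
    integral_subtype_comap measurableSet_Icc (fun t : ℝ => G ⌊(2 : ℝ) ^ m * t⌋₊),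
    integral_Icc_eq_integral_Ioc, ← intervalIntegral.integral_of_le zero_le_one,
    intervalIntegral.integral_comp_mul_left (fun s => G ⌊s⌋₊) (by positivity), mul_zero, mul_one,
    ← intervalIntegral_floor]
  push_cast
  rfl

/-- The Rademacher functions `1, -1, 1, -1, …` on the successive dyadic intervals of length
`2 ^ -(i + 1)`. -/
noncomputable def rademacher (i : ℕ) (t : unitInterval) : ℝ := (-1) ^ ⌊(2 : ℝ) ^ (i + 1) * t⌋₊

theorem isDyadic_rademacher (i : ℕ) : IsDyadic (i + 1) (rademacher i) :=
  ⟨fun k => (-1) ^ k, fun _ => rfl⟩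

theorem abs_rademacher (i : ℕ) (t : unitInterval) : |rademacher i t| = 1 := by
  simp [rademacher]

theorem rademacher_mul_self (i : ℕ) (t : unitInterval) : rademacher i t * rademacher i t = 1 := by
  rw [rademacher, ← mul_pow]
  simp

/-- `rademacher m` integrates to zero over each dyadic interval of length `2 ^ -m`. -/
theorem IsDyadic.integral_rademacher_smul [CompleteSpace F] {m : ℕ} {f : unitInterval → F}
    (hf : IsDyadic m f) : ∫ t, rademacher m t • f t = 0 := by
  obtain ⟨G, hG⟩ := hf
  have h1 : ∀ t : unitInterval, rademacher m t • f t =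
      (fun k : ℕ => (-1 : ℝ) ^ k • G (k / 2)) ⌊(2 : ℝ) ^ (m + 1) * t⌋₊ := by
    intro t
    rw [hG, floor_two_pow_mul_div m.le_succ, rademacher]
    simp
  have h2 : ∀ N : ℕ, ∑ k ∈ Finset.range (2 * N), (-1 : ℝ) ^ k • G (k / 2) = 0 := by
    intro N
    induction N with
    | zero => simp
    | succ N ih =>
      rw [mul_add, mul_one, Finset.sum_range_succ, Finset.sum_range_succ, ih]
      have e1 : 2 * N / 2 = N := by omega
      have e2 : (2 * N + 1) / 2 = N := by omega
      rw [e1, e2, pow_succ, pow_mul]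
      simp
  simp_rw [h1]
  rw [integral_floor_two_pow (fun k : ℕ => (-1 : ℝ) ^ k • G (k / 2)),
    show 2 ^ (m + 1) = 2 * 2 ^ m from pow_succ' 2 m, h2, smul_zero]

/-- The Walsh functions: products of distinct Rademacher functions. -/
noncomputable def walsh (A : Finset ℕ) (t : unitInterval) : ℝ := ∏ i ∈ A, rademacher i t

theorem walsh_empty (t : unitInterval) : walsh ∅ t = 1 := Finset.prod_empty

theorem walsh_singleton (i : ℕ) (t : unitInterval) : walsh {i} t = rademacher i t :=
  Finset.prod_singleton _ _

theorem abs_walsh (A : Finset ℕ) (t : unitInterval) : |walsh A t| = 1 := by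
  rw [walsh, Finset.abs_prod]
  exact Finset.prod_eq_one fun i _ => abs_rademacher i t

theorem rademacher_mul_walsh_erase {A : Finset ℕ} {i : ℕ} (hi : i ∈ A) (t : unitInterval) :
    rademacher i t * walsh (A.erase i) t = walsh A t :=
  Finset.mul_prod_erase A (fun j => rademacher j t) hi

theorem isDyadic_walsh {A : Finset ℕ} {m : ℕ} (hA : A ⊆ Finset.range m) :
    IsDyadic m (walsh A) := by
  induction A using Finset.induction_on with
  | empty => simpa [funext walsh_empty] using IsDyadic.const m (1 : ℝ)
  | insert i A hi ih =>
    have h1 : walsh (insert i A) = fun t => rademacher i t * walsh A t :=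
      funext fun t => Finset.prod_insert hi
    rw [h1]
    rw [Finset.insert_subset_iff] at hA
    exact ((isDyadic_rademacher i).mono (Finset.mem_range.1 hA.1)).comp₂ (ih hA.2) (· * ·)

theorem measurable_walsh (A : Finset ℕ) : Measurable (walsh A) :=
  (isDyadic_walsh A.exists_nat_subset_range.choose_spec).measurable

/-- Only the Walsh functions `walsh A` with `A ⊆ {0, …, m - 1}` contribute to a dyadic function of
level `m`; for other `A`, the Rademacher function of largest index in `walsh A` integrates to zero
against the remaining factors. -/
theorem IsDyadic.integral_walsh_smul [CompleteSpace F] {m : ℕ} {f : unitInterval → F}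
    (hf : IsDyadic m f) {A : Finset ℕ} (hA : ¬ A ⊆ Finset.range m) :
    ∫ t, walsh A t • f t = 0 := by
  obtain ⟨i, hi, him⟩ := Finset.not_subset.1 hA
  have hne : A.Nonempty := ⟨i, hi⟩
  set M := A.max' hne with hM
  have hmM : m ≤ M := (not_lt.1 (by simpa using him)).trans (A.le_max' i hi)
  have hsub : A.erase M ⊆ Finset.range M := fun j hj =>
    Finset.mem_range.2 (A.lt_max'_of_mem_erase_max' hne hj)
  have h1 := ((isDyadic_walsh hsub).comp₂ (hf.mono hmM) (· • ·)).integral_rademacher_smul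
  refine Eq.trans (integral_congr_ae (Eventually.of_forall fun t => ?_)) h1
  simp only [smul_smul]
  rw [rademacher_mul_walsh_erase (A.max'_mem hne)]

/-- Orthogonality of the Walsh functions to the Rademacher functions. -/
theorem integral_walsh_mul_rademacher {A : Finset ℕ} {k : ℕ} (hA : A ≠ {k}) :
    ∫ t, walsh A t * rademacher k t = 0 := by
  by_cases h1 : A ⊆ Finset.range (k + 1)
  · by_cases hk : k ∈ A
    · have h2 : ¬ A.erase k ⊆ Finset.range 0 := by
        rw [Finset.range_zero, Finset.subset_empty]
        intro h
        rcases (Finset.erase_eq_empty_iff A k).1 h with rfl | h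
        · simp at hk
        · exact hA h
      have h3 := (IsDyadic.const 0 (1 : ℝ)).integral_walsh_smul h2
      refine Eq.trans (integral_congr_ae (Eventually.of_forall fun t => ?_)) h3
      simp only [smul_eq_mul, mul_one]
      rw [← rademacher_mul_walsh_erase hk, mul_comm, ← mul_assoc, rademacher_mul_self, one_mul]
    · have h2 : A ⊆ Finset.range k := fun j hj => by
        have := Finset.mem_range.1 (h1 hj)
        refine Finset.mem_range.2 (lt_of_le_of_ne (Nat.lt_succ_iff.1 this) ?_)
        rintro rfl
        exact hk hj
      simpa [mul_comm] using (isDyadic_walsh h2).integral_rademacher_smul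
  · simpa using (isDyadic_rademacher k).integral_walsh_smul h1

end Dyadic

/-! ### Operators on `L¹[0,1]` with prescribed Walsh coefficients -/

section WalshOperator

variable {𝕜 : Type*} [RCLike 𝕜]

theorem integrable_walsh_smul (A : Finset ℕ) (u : LOne 𝕜) :
    Integrable (fun t => walsh A t • u t) :=
  (L1.integrable_coeFn u).bdd_smul 1 (measurable_walsh A).aestronglyMeasurable
    (Eventually.of_forall fun t => (abs_walsh A t).le)

/-- The Walsh coefficient `u ↦ ∫ walsh A * u`, as a functional on `L¹[0,1]`. -/
noncomputable def walshCoeff (𝕜 : Type*) [RCLike 𝕜] (A : Finset ℕ) : StrongDual 𝕜 (LOne 𝕜) :=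
  LinearMap.mkContinuous
    { toFun := fun u => ∫ t, walsh A t • u t
      map_add' := fun u v => by
        rw [← integral_add (integrable_walsh_smul A u) (integrable_walsh_smul A v)]
        refine integral_congr_ae ?_
        filter_upwards [Lp.coeFn_add u v] with t ht
        rw [ht, Pi.add_apply, smul_add]
      map_smul' := fun c u => by
        rw [RingHom.id_apply, ← integral_smul]
        refine integral_congr_ae ?_
        filter_upwards [Lp.coeFn_smul c u] with t ht
        rw [ht, Pi.smul_apply, smul_comm] }
    1 fun u => by
      rw [one_mul, L1.norm_eq_integral_norm]
      refine (norm_integral_le_integral_norm _).trans (le_of_eq ?_)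
      refine integral_congr_ae (Eventually.of_forall fun t => ?_)
      simp only [norm_smul, Real.norm_eq_abs, abs_walsh, one_mul]

theorem walshCoeff_apply (A : Finset ℕ) (u : LOne 𝕜) :
    walshCoeff 𝕜 A u = ∫ t, walsh A t • u t := rfl

theorem walshCoeff_toLp (A : Finset ℕ) {m : ℕ} {h : unitInterval → 𝕜} (hh : IsDyadic m h) :
    walshCoeff 𝕜 A ((hh.memLp 1).toLp h) = ∫ t, walsh A t • h t := by
  rw [walshCoeff_apply]
  refine integral_congr_ae ?_
  filter_upwards [(hh.memLp 1).coeFn_toLp] with t ht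
  rw [ht]

theorem isDyadic_rademacher_ofReal (𝕜 : Type*) [RCLike 𝕜] (k : ℕ) :
    IsDyadic (k + 1) fun t => (rademacher k t : 𝕜) :=
  (isDyadic_rademacher k).comp RCLike.ofReal

/-- The Rademacher functions as elements of `L¹[0,1]`. -/
noncomputable def rademacherLOne (𝕜 : Type*) [RCLike 𝕜] (k : ℕ) : LOne 𝕜 :=
  ((isDyadic_rademacher_ofReal 𝕜 k).memLp 1).toLp _

theorem coeFn_rademacherLOne (k : ℕ) :
    rademacherLOne 𝕜 k =ᵐ[volume] fun t => (rademacher k t : 𝕜) :=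
  ((isDyadic_rademacher_ofReal 𝕜 k).memLp 1).coeFn_toLp

theorem walshCoeff_rademacherLOne (A : Finset ℕ) (k : ℕ) :
    walshCoeff 𝕜 A (rademacherLOne 𝕜 k) = if A = {k} then 1 else 0 := by
  rw [rademacherLOne, walshCoeff_toLp A (isDyadic_rademacher_ofReal 𝕜 k)]
  have h1 : ∀ t, walsh A t • (rademacher k t : 𝕜) = ((walsh A t * rademacher k t : ℝ) : 𝕜) := by
    intro t
    rw [RCLike.real_smul_eq_coe_mul, RCLike.ofReal_mul]
  simp_rw [h1]
  rw [integral_ofReal]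
  split_ifs with h
  · subst h
    simp [walsh_singleton, rademacher_mul_self]
  · rw [integral_walsh_mul_rademacher h, RCLike.ofReal_zero]

theorem isDyadic_sum_rademacher (c : ℕ → 𝕜) (N : ℕ) :
    IsDyadic N fun t => ∑ k ∈ Finset.range N, (rademacher k t : 𝕜) * c k := by
  induction N with
  | zero => simpa using IsDyadic.const 0 (0 : 𝕜)
  | succ N ih =>
    simp_rw [Finset.sum_range_succ]
    exact (ih.mono N.le_succ).comp₂ (isDyadic_rademacher N) fun x r => x + (r : 𝕜) * c N

theorem integral_norm_sq_sum_rademacher (c : ℕ → 𝕜) (N : ℕ) :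
    ∫ t, ‖∑ k ∈ Finset.range N, (rademacher k t : 𝕜) * c k‖ ^ 2 =
      ∑ k ∈ Finset.range N, ‖c k‖ ^ 2 := by
  induction N with
  | zero => simp
  | succ N ih =>
    have h1 : ∀ t, ‖∑ k ∈ Finset.range (N + 1), (rademacher k t : 𝕜) * c k‖ ^ 2 =
        ‖∑ k ∈ Finset.range N, (rademacher k t : 𝕜) * c k‖ ^ 2 +
        rademacher N t • (2 * RCLike.re (inner 𝕜
          (∑ k ∈ Finset.range N, (rademacher k t : 𝕜) * c k) (c N))) + ‖c N‖ ^ 2 := by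
      intro t
      rw [Finset.sum_range_succ, norm_add_sq (𝕜 := 𝕜), ← smul_eq_mul (rademacher N t : 𝕜),
        inner_smul_right, RCLike.re_ofReal_mul, norm_smul, RCLike.norm_ofReal, abs_rademacher,
        one_mul, smul_eq_mul]
      ring
    have h2 := ((isDyadic_sum_rademacher c N).comp fun x => 2 * RCLike.re (inner 𝕜 x (c N)))
    have h3 : Integrable fun t => rademacher N t • (2 * RCLike.re (inner 𝕜
          (∑ k ∈ Finset.range N, (rademacher k t : 𝕜) * c k) (c N))) :=
      IsDyadic.integrable (𝕜 := ℝ) ((isDyadic_rademacher N).comp₂ (h2.mono N.le_succ) (· • ·))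
    have h4 : Integrable fun t => ‖∑ k ∈ Finset.range N, (rademacher k t : 𝕜) * c k‖ ^ 2 :=
      IsDyadic.integrable (𝕜 := ℝ) ((isDyadic_sum_rademacher c N).comp fun x => ‖x‖ ^ 2)
    simp_rw [h1]
    rw [integral_add (f := fun t => _ + _) (h4.add h3) (integrable_const _), integral_add h4 h3, ih,
      h2.integral_rademacher_smul, Finset.sum_range_succ]
    simp

/-- The Rademacher functions are weakly null in `L¹`. This is Bessel's inequality, applied to the
restriction of a functional to `L²`; it is proved here by testing the functional on
`∑ k < N, conj (φ r_k) • r_k`. -/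
theorem tendsto_apply_rademacherLOne (φ : StrongDual 𝕜 (LOne 𝕜)) :
    Tendsto (fun k => φ (rademacherLOne 𝕜 k)) atTop (𝓝 0) := by
  set C : ℝ := ‖φ‖ + 1 with hC
  have hC0 : 0 < C := by positivity
  have hsum : ∀ N, ∑ k ∈ Finset.range N, ‖φ (rademacherLOne 𝕜 k)‖ ^ 2 ≤ C ^ 2 := by
    intro N
    set S := ∑ k ∈ Finset.range N, ‖φ (rademacherLOne 𝕜 k)‖ ^ 2 with hS
    -- the factor `C⁻¹` lets the inequality `2 * ‖z‖ ≤ 1 + ‖z‖ ^ 2` replace Cauchy-Schwarz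
    set c : ℕ → 𝕜 := fun k => (C⁻¹ : ℝ) * (starRingEnd 𝕜) (φ (rademacherLOne 𝕜 k)) with hc
    have hcn : ∀ k, ‖c k‖ ^ 2 = (C ^ 2)⁻¹ * ‖φ (rademacherLOne 𝕜 k)‖ ^ 2 := by
      intro k
      rw [hc, norm_mul, RCLike.norm_ofReal, RCLike.norm_conj, mul_pow, sq_abs, inv_pow]
    set f : LOne 𝕜 := ∑ k ∈ Finset.range N, c k • rademacherLOne 𝕜 k with hf
    have hφf : φ f = ((C⁻¹ * S : ℝ) : 𝕜) := by
      rw [hf, map_sum, hS, Finset.mul_sum, RCLike.ofReal_sum]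
      refine Finset.sum_congr rfl fun k _ => ?_
      rw [map_smul, smul_eq_mul, hc]
      push_cast
      rw [mul_assoc, RCLike.conj_mul]
    have hae : ∀ᵐ t, f t = ∑ k ∈ Finset.range N, (rademacher k t : 𝕜) * c k := by
      have h1 : ∀ᵐ t, ∀ k, (c k • rademacherLOne 𝕜 k : LOne 𝕜) t = (rademacher k t : 𝕜) * c k := by
        rw [ae_all_iff]
        intro k
        filter_upwards [Lp.coeFn_smul (c k) (rademacherLOne 𝕜 k),
          coeFn_rademacherLOne (𝕜 := 𝕜) k] with t h2 h3
        rw [h2, Pi.smul_apply, h3, smul_eq_mul, mul_comm]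
      filter_upwards [h1, Lp.coeFn_finsetSum (Finset.range N) fun k => c k • rademacherLOne 𝕜 k]
        with t h2 h3
      rw [hf, h3, Finset.sum_apply]
      exact Finset.sum_congr rfl fun k _ => h2 k
    have hint : Integrable fun t => ‖∑ k ∈ Finset.range N, (rademacher k t : 𝕜) * c k‖ ^ 2 :=
      IsDyadic.integrable (𝕜 := ℝ) ((isDyadic_sum_rademacher c N).comp fun x => ‖x‖ ^ 2)
    have hfn : 2 * ‖f‖ ≤ 1 + (C ^ 2)⁻¹ * S := by
      rw [L1.norm_eq_integral_norm, ← integral_const_mul]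
      calc ∫ t, 2 * ‖f t‖ ≤ ∫ t, (1 + ‖∑ k ∈ Finset.range N, (rademacher k t : 𝕜) * c k‖ ^ 2) := by
            refine integral_mono_ae ((L1.integrable_coeFn f).norm.const_mul 2)
              ((integrable_const 1).add hint) ?_
            filter_upwards [hae] with t ht
            rw [ht]
            nlinarith [sq_nonneg (‖∑ k ∈ Finset.range N, (rademacher k t : 𝕜) * c k‖ - 1)]
        _ = 1 + (C ^ 2)⁻¹ * S := by
            rw [integral_add (integrable_const 1) hint, integral_norm_sq_sum_rademacher]
            simp [hcn, hS, Finset.mul_sum]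
    have hS0 : 0 ≤ S := Finset.sum_nonneg fun _ _ => by positivity
    have h1 : C⁻¹ * S ≤ C * ‖f‖ := by
      have h2 := φ.le_opNorm f
      rw [hφf, RCLike.norm_ofReal, abs_of_nonneg (by positivity)] at h2
      exact h2.trans (by gcongr; linarith)
    have h2 : 2 * S ≤ C ^ 2 * (2 * ‖f‖) := by
      rw [inv_mul_le_iff₀ hC0] at h1
      linarith
    have h3 : C ^ 2 * (2 * ‖f‖) ≤ C ^ 2 + S := by
      calc C ^ 2 * (2 * ‖f‖) ≤ C ^ 2 * (1 + (C ^ 2)⁻¹ * S) := by gcongr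
        _ = C ^ 2 + S := by field_simp
    linarith
  have h1 : Tendsto (fun k => ‖φ (rademacherLOne 𝕜 k)‖ ^ 2) atTop (𝓝 0) :=
    (summable_of_sum_range_le (fun _ => by positivity) hsum).tendsto_atTop_zero
  rw [tendsto_zero_iff_norm_tendsto_zero]
  simpa using h1.sqrt

variable {X : Type*} [NormedAddCommGroup X] [NormedSpace 𝕜 X]

/-- The operator `u ↦ ∑ (∫ walsh A * u) • x A`, the sum running over the subsets `A` of
`{0, …, n - 1}`. -/
noncomputable def walshSum (x : Finset ℕ → X) (n : ℕ) : LOne 𝕜 →L[𝕜] X :=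
  ∑ A ∈ (Finset.range n).powerset, (walshCoeff 𝕜 A).smulRight (x A)

theorem walshSum_apply (x : Finset ℕ → X) (n : ℕ) (u : LOne 𝕜) :
    walshSum x n u = ∑ A ∈ (Finset.range n).powerset, walshCoeff 𝕜 A u • x A := by
  simp [walshSum]

theorem walshSum_eq_of_isDyadic {x : Finset ℕ → X} {m n : ℕ} (hmn : m ≤ n)
    {h : unitInterval → 𝕜} (hh : IsDyadic m h) :
    (walshSum x n : LOne 𝕜 →L[𝕜] X) ((hh.memLp 1).toLp h) =
      walshSum x m ((hh.memLp 1).toLp h) := by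
  rw [walshSum_apply, walshSum_apply]
  refine (Finset.sum_subset (Finset.powerset_mono.2 (Finset.range_mono hmn)) fun A _ hA => ?_).symm
  rw [walshCoeff_toLp A hh, hh.integral_walsh_smul (by simpa using hA), zero_smul]

theorem exists_isDyadic_toLp_norm_sub_le (u : LOne 𝕜) {η : ℝ} (hη : 0 < η) :
    ∃ m, ∃ h : unitInterval → 𝕜, ∃ hh : IsDyadic m h, ‖u - (hh.memLp 1).toLp h‖ ≤ η := by
  obtain ⟨_, ⟨c, rfl⟩, hc⟩ := Metric.mem_closure_iff.1
    (ContinuousMap.toLp_denseRange 𝕜 (volume : Measure unitInterval) 𝕜 ENNReal.one_ne_top u)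
    (η / 2) (half_pos hη)
  obtain ⟨m, h, hh, hch⟩ := exists_isDyadic_norm_sub_le c (half_pos hη)
  refine ⟨m, h, hh, ?_⟩
  have h1 : ‖ContinuousMap.toLp 1 volume 𝕜 c - (hh.memLp 1).toLp h‖ ≤ η / 2 := by
    rw [L1.norm_eq_integral_norm]
    refine (integral_mono_ae (g := fun _ => η / 2) (L1.integrable_coeFn _).norm
      (integrable_const _) ?_).trans (by simp)
    filter_upwards [Lp.coeFn_sub (ContinuousMap.toLp 1 volume 𝕜 c) ((hh.memLp 1).toLp h),
      ContinuousMap.coeFn_toLp (p := 1) (𝕜 := 𝕜) volume c, (hh.memLp 1).coeFn_toLp] with t h1 h2 h3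
    rw [h1, Pi.sub_apply, h2, h3]
    exact hch t
  rw [dist_eq_norm] at hc
  have := norm_sub_le_norm_sub_add_norm_sub u (ContinuousMap.toLp 1 volume 𝕜 c)
    ((hh.memLp 1).toLp h)
  linarith

variable [NormedSpace ℝ X] [IsScalarTower ℝ 𝕜 X]

/-- `walshSum x n` is integration against the martingale `∑ A, walsh A • x A`. -/
theorem norm_walshSum_apply_le [CompleteSpace X] {x : Finset ℕ → X} {C : ℝ} {n : ℕ}
    (hx : ∀ t, ‖∑ A ∈ (Finset.range n).powerset, walsh A t • x A‖ ≤ C) (u : LOne 𝕜) :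
    ‖walshSum x n u‖ ≤ C * ‖u‖ := by
  have h1 : walshSum x n u =
      ∫ t, u t • ∑ A ∈ (Finset.range n).powerset, walsh A t • x A := by
    rw [walshSum_apply]
    simp_rw [walshCoeff_apply, ← integral_smul_const]
    rw [← integral_finsetSum _ fun A _ => (integrable_walsh_smul A u).smul_const (x A)]
    refine integral_congr_ae (Eventually.of_forall fun t => ?_)
    simp only [Finset.smul_sum]
    refine Finset.sum_congr rfl fun A _ => ?_
    rw [smul_assoc]
    exact (smul_algebra_smul_comm _ _ _).symm
  rw [h1, L1.norm_eq_integral_norm, ← integral_const_mul]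
  refine norm_integral_le_of_norm_le ((L1.integrable_coeFn u).norm.const_mul C)
    (Eventually.of_forall fun t => ?_)
  rw [norm_smul, mul_comm]
  gcongr
  exact hx t

/-- A bounded `X`-valued dyadic martingale, given by its Walsh coefficients `x A`, defines an
operator `L¹[0,1] → X`, which maps the `k`-th Rademacher function to `x {k}`. -/
theorem exists_operator_of_walsh [CompleteSpace X] {x : Finset ℕ → X} {C : ℝ}
    (hx : ∀ n t, ‖∑ A ∈ (Finset.range n).powerset, walsh A t • x A‖ ≤ C) :
    ∃ S : LOne 𝕜 →L[𝕜] X, (∀ k, S (rademacherLOne 𝕜 k) = x {k}) ∧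
      ∀ u, S u ∈ (Submodule.span 𝕜 (Set.range x)).topologicalClosure := by
  have hC : 0 ≤ C := (norm_nonneg _).trans (hx 0 0)
  -- `walshSum x n` is eventually constant in `n` on dyadic functions, which are dense
  have hcauchy : ∀ u : LOne 𝕜, CauchySeq fun n => walshSum x n u := by
    intro u
    rw [Metric.cauchySeq_iff']
    intro ε hε
    obtain ⟨m, h, hh, hu⟩ := exists_isDyadic_toLp_norm_sub_le u
      (η := ε / (2 * (C + 1))) (by positivity)
    refine ⟨m, fun n hn => ?_⟩
    rw [dist_eq_norm]
    set w := (hh.memLp 1).toLp h with hw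
    have e : walshSum x n u - walshSum x m u =
        walshSum x n (u - w) - walshSum x m (u - w) := by
      rw [map_sub, map_sub, hw, walshSum_eq_of_isDyadic hn hh]
      abel
    calc ‖walshSum x n u - walshSum x m u‖ ≤ C * ‖u - w‖ + C * ‖u - w‖ := by
          rw [e]
          exact (norm_sub_le _ _).trans
            (add_le_add (norm_walshSum_apply_le (hx n) _) (norm_walshSum_apply_le (hx m) _))
      _ ≤ C * (ε / (2 * (C + 1))) + C * (ε / (2 * (C + 1))) := by gcongr
      _ = ε * (C / (C + 1)) := by field_simp; ring
      _ < ε * 1 := by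
          gcongr
          rw [div_lt_one (by positivity)]
          linarith
      _ = ε := mul_one ε
  choose S hS using fun u => cauchySeq_tendsto_of_complete (hcauchy u)
  refine ⟨continuousLinearMapOfTendsto (fun n => (walshSum x n : LOne 𝕜 →L[𝕜] X))
    (tendsto_pi_nhds.2 hS), fun k => ?_, fun u => ?_⟩
  · refine tendsto_nhds_unique (hS _) (tendsto_const_nhds.congr' ?_)
    filter_upwards [eventually_gt_atTop k] with n hn
    rw [walshSum_apply]
    simp_rw [walshCoeff_rademacherLOne]
    rw [Finset.sum_eq_single {k}]
    · simp
    · intro A _ hA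
      rw [if_neg hA, zero_smul]
    · intro h
      exact absurd (by simpa using hn) h
  · refine mem_closure_of_tendsto (hS u) (Eventually.of_forall fun n => ?_)
    rw [walshSum_apply]
    exact Submodule.sum_mem _ fun A _ => Submodule.smul_mem _ _ (Submodule.subset_span ⟨A, rfl⟩)

end WalshOperator

/-! ### Riesz products and the martingale in `X` -/

section Martingale

variable {𝕜 : Type*} [RCLike 𝕜]

theorem norm_continuousToLOne_of_nonneg {h : C(unitInterval, ℝ)} (hh : ∀ t, 0 ≤ h t) :
    (‖continuousToLOne 𝕜 h‖ : 𝕜) = walshCoeff 𝕜 ∅ (continuousToLOne 𝕜 h) := by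
  rw [L1.norm_eq_integral_norm, walshCoeff_apply, ← integral_ofReal]
  refine integral_congr_ae ?_
  filter_upwards [coeFn_continuousToLOne (𝕜 := 𝕜) h] with t ht
  rw [ht, walsh_empty, one_smul, RCLike.norm_ofReal, abs_of_nonneg (hh t)]

theorem walshCoeff_empty_one : walshCoeff 𝕜 ∅ (continuousToLOne 𝕜 1) = 1 := by
  rw [walshCoeff_apply]
  have h1 : (fun t => walsh ∅ t • (continuousToLOne 𝕜 1) t) =ᵐ[volume] fun _ => (1 : 𝕜) := by
    filter_upwards [coeFn_continuousToLOne (𝕜 := 𝕜) 1] with t ht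
    rw [ht, walsh_empty]
    simp
  rw [integral_congr_ae h1]
  simp

/-- The Riesz products `∏ i < n, (1 + rᵢ(t) gᵢ)` are nonnegative functions of integral one, hence
have norm one in `L¹`. -/
theorem norm_continuousToLOne_rieszProduct {g : ℕ → C(unitInterval, ℝ)} (hg : ∀ n, ‖g n‖ ≤ 1)
    (hint : ∀ n, ∀ A ∈ (Finset.range n).powerset,
      walshCoeff 𝕜 ∅ (continuousToLOne 𝕜 (g n * ∏ i ∈ A, g i)) = 0)
    (n : ℕ) (t : unitInterval) :
    ‖continuousToLOne 𝕜 (∑ A ∈ (Finset.range n).powerset, walsh A t • ∏ i ∈ A, g i)‖ = 1 := by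
  have h0 : ∀ A : Finset ℕ, A ≠ ∅ → walshCoeff 𝕜 ∅ (continuousToLOne 𝕜 (∏ i ∈ A, g i)) = 0 := by
    intro A hA
    have hne := Finset.nonempty_iff_ne_empty.2 hA
    rw [← Finset.mul_prod_erase A g (A.max'_mem hne)]
    exact hint _ _ (Finset.mem_powerset.2 fun j hj =>
      Finset.mem_range.2 (A.lt_max'_of_mem_erase_max' hne hj))
  have h1 : ∑ A ∈ (Finset.range n).powerset, walsh A t • ∏ i ∈ A, g i =
      ∏ i ∈ Finset.range n, (1 + rademacher i t • g i) := by
    rw [Finset.prod_one_add]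
    exact Finset.sum_congr rfl fun A _ => by rw [walsh, Finset.prod_smul]
  have h2 : ∀ s, 0 ≤ (∑ A ∈ (Finset.range n).powerset, walsh A t • ∏ i ∈ A, g i) s := by
    intro s
    rw [h1, ContinuousMap.prod_apply]
    refine Finset.prod_nonneg fun i _ => ?_
    have h3 : |rademacher i t * g i s| ≤ 1 := by
      rw [abs_mul, abs_rademacher, one_mul]
      exact ((g i).norm_coe_le_norm s).trans (hg i)
    simpa using by linarith [(abs_le.1 h3).1]
  have h3 : walshCoeff 𝕜 ∅ (continuousToLOne 𝕜
      (∑ A ∈ (Finset.range n).powerset, walsh A t • ∏ i ∈ A, g i)) = 1 := by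
    rw [map_sum, map_sum, Finset.sum_eq_single ∅]
    · rw [Finset.prod_empty, walsh_empty, one_smul, walshCoeff_empty_one]
    · intro A _ hA
      rw [map_smul, ← algebraMap_smul 𝕜 (walsh A t), map_smul, h0 A hA, smul_zero]
    · simp
  rw [← norm_continuousToLOne_of_nonneg h2] at h3
  exact_mod_cast h3

variable {X : Type*} [NormedAddCommGroup X] [NormedSpace ℝ X]

/-- The common kernel of finitely many functionals on `C[0,1]` contains functions of norm at most
one with large image, so a sequence can be chosen whose products satisfy linear constraints imposed
by the earlier terms. -/
theorem exists_seq_mul_prod_mem_ker {K : C(unitInterval, ℝ) →L[ℝ] X} {δ : ℝ}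
    (hK : ∀ s : Finset (C(unitInterval, ℝ) →L[ℝ] 𝕜),
      ∃ y, ‖y‖ ≤ 1 ∧ (∀ φ ∈ s, φ y = 0) ∧ δ ≤ ‖K y‖)
    (Ψ : ℕ → (ℕ → C(unitInterval, ℝ)) → Finset (StrongDual 𝕜 (LOne 𝕜)))
    (hΨ : ∀ n g g', (∀ i < n, g i = g' i) → Ψ n g = Ψ n g') :
    ∃ g : ℕ → C(unitInterval, ℝ), ∀ n, ‖g n‖ ≤ 1 ∧ δ ≤ ‖K (g n)‖ ∧
      ∀ A ∈ (Finset.range n).powerset, ∀ ψ ∈ Ψ n g,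
        ψ (continuousToLOne 𝕜 (g n * ∏ i ∈ A, g i)) = 0 := by
  classical
  refine exists_seq_of_prefix (fun n g y => ‖y‖ ≤ 1 ∧ δ ≤ ‖K y‖ ∧
      ∀ A ∈ (Finset.range n).powerset, ∀ ψ ∈ Ψ n g,
        ψ (continuousToLOne 𝕜 (y * ∏ i ∈ A, g i)) = 0) ?_ ?_
  · rintro n g g' hgg y ⟨h1, h2, h3⟩
    refine ⟨h1, h2, fun A hA ψ hψ => ?_⟩
    rw [← hΨ n g g' hgg] at hψ
    rw [← h3 A hA ψ hψ, Finset.prod_congr rfl fun i hi =>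
      (hgg i (Finset.mem_range.1 (Finset.mem_powerset.1 hA hi))).symm]
  · intro n g
    obtain ⟨y, h1, h2, h3⟩ := hK (((Finset.range n).powerset ×ˢ Ψ n g).image fun p =>
      p.2.restrictScalars ℝ ∘L continuousToLOne 𝕜 ∘L
        (ContinuousLinearMap.mul ℝ C(unitInterval, ℝ)).flip (∏ i ∈ p.1, g i))
    exact ⟨y, h1, h3, fun A hA ψ hψ =>
      h2 _ (Finset.mem_image.2 ⟨(A, ψ), Finset.mk_mem_product hA hψ, rfl⟩)⟩

/-- Finite sets whose spans contain the values of the successive differences of the martingale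
`n ↦ ∑ A, walsh A • K (∏ i ∈ A, g i)`, `A ⊆ {0, …, n - 1}`: the initial value `K 1` has index `0`,
and the difference between times `n` and `n + 1` has index `n + 1`. -/
noncomputable def differenceSet (K : C(unitInterval, ℝ) →L[ℝ] X) (g : ℕ → C(unitInterval, ℝ)) :
    ℕ → Set X
  | 0 => {K 1}
  | n + 1 => (fun A => K (g n * ∏ i ∈ A, g i)) '' (Finset.range n).powerset

theorem finite_differenceSet (K : C(unitInterval, ℝ) →L[ℝ] X) (g : ℕ → C(unitInterval, ℝ))
    (n : ℕ) : (differenceSet K g n).Finite := by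
  cases n with
  | zero => exact Set.finite_singleton _
  | succ n => exact (Finset.finite_toSet _).image _

theorem differenceSet_subset (K : C(unitInterval, ℝ) →L[ℝ] X) (g : ℕ → C(unitInterval, ℝ))
    {i j : ℕ} (hij : i ≤ j) :
    differenceSet K g i ⊆ (fun A => K (∏ i ∈ A, g i)) '' (Finset.range j).powerset := by
  cases i with
  | zero =>
    rintro _ rfl
    exact ⟨∅, by simp, by simp⟩
  | succ n =>
    rintro _ ⟨A, hA, rfl⟩
    have hA' : A ⊆ Finset.range n := Finset.mem_powerset.1 hA
    refine ⟨insert n A, ?_, ?_⟩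
    · rw [Finset.mem_coe, Finset.mem_powerset, Finset.insert_subset_iff]
      exact ⟨Finset.mem_range.2 hij, hA'.trans (Finset.range_mono (by omega))⟩
    · simp only
      rw [Finset.prod_insert fun h => by simpa using hA' h]

theorem mem_differenceSet (K : C(unitInterval, ℝ) →L[ℝ] X) (g : ℕ → C(unitInterval, ℝ))
    (A : Finset ℕ) : ∃ n, K (∏ i ∈ A, g i) ∈ differenceSet K g n := by
  rcases A.eq_empty_or_nonempty with rfl | hne
  · exact ⟨0, by simp [differenceSet]⟩
  · refine ⟨A.max' hne + 1, A.erase (A.max' hne), ?_, ?_⟩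
    · exact Finset.mem_powerset.2 fun j hj =>
        Finset.mem_range.2 (A.lt_max'_of_mem_erase_max' hne hj)
    · simp only
      rw [Finset.mul_prod_erase A g (A.max'_mem hne)]

end Martingale

/-! ### The subspace with a decomposition -/

/-- A Banach space failing the CCP has, for each `ε > 0`, a closed subspace that fails the CCP and
has a finite dimensional decomposition with constant at most `1 + ε`. -/
theorem corollary3 {𝕜 : Type*} [RCLike 𝕜]
    {X : Type*} [NormedAddCommGroup X] [NormedSpace 𝕜 X] [CompleteSpace X]
    (hX : ¬ CompleteContinuityProperty 𝕜 X) (ε : ℝ) (hε : 0 < ε) :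
    ∃ Y : Submodule 𝕜 X, IsClosed (Y : Set X) ∧
      (∃ V : ℕ → Submodule 𝕜 Y, IsFDDWithConstantLE V (1 + ε)) ∧
      ¬ CompleteContinuityProperty 𝕜 Y := by
  classical
  let : NormedSpace ℝ X := NormedSpace.restrictScalars ℝ 𝕜 X
  have : IsScalarTower ℝ 𝕜 X := RestrictScalars.isScalarTower ℝ 𝕜 X
  obtain ⟨T, hT⟩ := not_forall.1 hX
  set K := restrictContinuous T with hKdef
  obtain ⟨δ, hδ, hK⟩ : ∃ δ > 0, ∀ s : Finset (C(unitInterval, ℝ) →L[ℝ] 𝕜),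
      ∃ y, ‖y‖ ≤ 1 ∧ (∀ φ ∈ s, φ y = 0) ∧ δ ≤ ‖K y‖ := by
    by_contra! hcon
    exact hT (isCompletelyContinuous_of_totallyBounded T fun M =>
      totallyBounded_image_closedBall (𝕜 := 𝕜) K hcon M)
  -- `F S` is a finite set of functionals that norms the span of the finite set `S`
  choose F hF1 hF2 using fun S : Finset X =>
    exists_finset_norming (Submodule.span 𝕜 (S : Set X)) hε
  let S : ℕ → (ℕ → C(unitInterval, ℝ)) → Finset X := fun j g =>
    (Finset.range j).powerset.image fun A => K (∏ i ∈ A, g i)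
  obtain ⟨g, hg⟩ := exists_seq_mul_prod_mem_ker hK
    (fun n g => insert (walshCoeff 𝕜 ∅)
      ((Finset.range (n + 1)).biUnion fun j => (F (S j g)).image fun φ => φ ∘L T)) (by
    intro n g g' hgg
    have hS : ∀ j ∈ Finset.range (n + 1), S j g = S j g' := by
      intro j hj
      refine Finset.image_congr fun A hA => ?_
      have hA' := Finset.mem_powerset.1 hA
      rw [Finset.prod_congr rfl fun i hi => hgg i ?_]
      have h1 := Finset.mem_range.1 (hA' hi)
      have h2 := Finset.mem_range.1 hj
      omega
    congr 1
    exact Finset.biUnion_congr rfl fun j hj => by rw [hS j hj])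
  set V : ℕ → Submodule 𝕜 X := fun n => Submodule.span 𝕜 (differenceSet K g n) with hV
  have hVS : ∀ i j, i ≤ j → V i ≤ Submodule.span 𝕜 (S j g : Set X) := fun i j hij =>
    Submodule.span_mono (by simpa [S] using differenceSet_subset K g hij)
  -- `V i` is annihilated by the functionals that norm the earlier spaces
  have hker : ∀ i j, j < i → ∀ φ ∈ F (S j g), ∀ v ∈ V i, φ v = 0 := by
    intro i j hji φ hφ v hv
    obtain ⟨k, rfl⟩ : ∃ k, i = k + 1 := ⟨i - 1, by omega⟩
    have : V (k + 1) ≤ (φ : X →ₗ[𝕜] 𝕜).ker := by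
      refine Submodule.span_le.2 ?_
      rintro _ ⟨A, hA, rfl⟩
      exact (hg k).2.2 A hA (φ ∘L T) (Finset.mem_insert_of_mem (Finset.mem_biUnion.2
        ⟨j, Finset.mem_range.2 hji, Finset.mem_image_of_mem _ hφ⟩))
    exact this hv
  have hsum : ∀ v : ℕ → X, (∀ i, v i ∈ V i) → ∀ n m, n ≤ m →
      ‖∑ i ∈ Finset.range n, v i‖ ≤ (1 + ε) * ‖∑ i ∈ Finset.range m, v i‖ := by
    intro v hv n m hnm
    rcases n with _ | j
    · simpa using by positivity
    have hmem : ∑ i ∈ Finset.range (j + 1), v i ∈ Submodule.span 𝕜 (S j g : Set X) :=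
      Submodule.sum_mem _ fun i hi =>
        hVS i j (Nat.lt_succ_iff.1 (Finset.mem_range.1 hi)) (hv i)
    obtain ⟨φ, hφ, hle⟩ := hF2 (S j g) _ hmem
    have e : φ (∑ i ∈ Finset.range (j + 1), v i) = φ (∑ i ∈ Finset.range m, v i) := by
      rw [map_sum, map_sum]
      refine Finset.sum_subset (Finset.range_mono hnm) fun i _ hi => ?_
      exact hker i j (by simpa using hi) φ hφ _ (hv i)
    rw [e] at hle
    refine hle.trans ?_
    gcongr
    simpa using φ.le_of_opNorm_le (hF1 _ φ hφ) (∑ i ∈ Finset.range m, v i)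
  have hfd : ∀ n, FiniteDimensional 𝕜 (V n) := fun n =>
    FiniteDimensional.span_of_finite 𝕜 (finite_differenceSet K g n)
  refine ⟨(⨆ n, V n).topologicalClosure, Submodule.isClosed_topologicalClosure _,
    ⟨_, isFDDWithConstantLE_of_norm_sum_le hfd hsum⟩, fun hY => ?_⟩
  obtain ⟨R, hRr, hRmem⟩ := exists_operator_of_walsh (𝕜 := 𝕜) (C := ‖T‖)
    (x := fun A => K (∏ i ∈ A, g i)) (by
      intro n t
      simp_rw [← map_smul K]
      rw [← map_sum, hKdef, restrictContinuous_apply]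
      refine (T.le_opNorm _).trans (le_of_eq ?_)
      rw [norm_continuousToLOne_rieszProduct (fun n => (hg n).1)
        (fun n A hA => (hg n).2.2 A hA _ (Finset.mem_insert_self _ _)), mul_one])
  have hle : (Submodule.span 𝕜 (Set.range fun A => K (∏ i ∈ A, g i))).topologicalClosure ≤
      (⨆ n, V n).topologicalClosure := by
    refine Submodule.topologicalClosure_mono (Submodule.span_le.2 ?_)
    rintro _ ⟨A, rfl⟩
    obtain ⟨n, hn⟩ := mem_differenceSet K g A
    exact (le_iSup V n) (Submodule.subset_span hn)
  have hcc := hY (R.codRestrict _ fun u => hle (hRmem u)) (rademacherLOne 𝕜) 0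
    (tendsto_toWeakSpace_iff.2 fun φ => by simpa using tendsto_apply_rademacherLOne φ)
  have hnorm := hcc.norm
  rw [map_zero, norm_zero] at hnorm
  refine hδ.not_ge (ge_of_tendsto' hnorm fun k => ?_)
  rw [Submodule.coe_norm, ContinuousLinearMap.coe_codRestrict_apply, hRr, Finset.prod_singleton]
  exact (hg k).2.1
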